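/- Let $K$ be a field and let $Q$ be the quiver with vertices $1,3,5,1',3',5',2,4,6$ and arrows $$\bar a_1:1\to3,\ \bar a_2:5\to3,\ \bar a_3:5\to1,\quad \bar b_1:3\to2,\ \bar b_2:3\to4,\ \bar b_3:1\to6,\quad \bar c_1:2\to1,\ \bar c_2:4\to5,\ \bar c_3:6\to5,$$ $$\bar a_1':1'\to3',\ \bar a_2':5'\to3',\ \bar a_3':5'\to1',\quad \bar b_1':3'\to2,\ \bar b_2':3'\to4,\ \bar b_3':1'\to6,\quad \bar c_1':2\to1',\ \bar c_2':4\to5',\ \bar c_3':6\to5'.$$ Let $\Lambda=KQ/\langle \bar a_i\bar b_i,\ \bar b_i\bar c_i',\ \bar c_i\bar a_i,\ \bar a_i'\bar b_i',\ \bar b_i'\bar c_i,\ \bar c_i'\bar a_i' : i=1,2,3\rangle$, where $\alpha\beta$ is the path $\alpha$ followed by $\beta$. Let $g$ be the automorphism of $\Lambda$ of order two that exchanges $\bar\alpha$ and $\bar\alpha'$ for every arrow, exchanges $i$ and $i'$ for $i=1,3,5$, and fixes the vertices $2,4,6$; for a module $M$ put ${}^gM=M\circ g^{-1}$. Modules are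 left modules. *Strings.* A string is a non-empty word $\alpha_1\cdots\alpha_n$ in the arrows and their formal inverses, with consecutive letters composable and not inverse to each other, such that neither the word nor its inverse contains one of the above zero relations. A band is a cyclic string all of whose powers are strings and which is not a proper power of a string. For strings with the same first letter put $S<T$ if $T=S\phi^{-1}X$, or $S=T\psi X$, or $S=P\psi W$ and $T=P\phi^{-1}X$, for some arrows $\phi,\psi$ and words $P,W,X$. A pair $(A,B)$ of different bands is $Q$-generating if $A$ and $B$ start with the same direct arrow and end with the same inverse arrow, $A<B$, and neither of $A$, $B$ is a prolongation of the other ($A\ne BX$ and $B\ne AX$ for all words $X$). Let $\Sigma(A,B)$ be the set of finite words over the alphabet $\{A,B\}$, including the empty word, and $L^T_S(A,B)=\{SXTA : X\in\Sigma(A,B)\}$. The string module $M(S)$ of $S=\alpha_1\cdots\alpha_n$ has the $K$-basis $z_1^S,\dots,z_{n+1}^S$; an arrow $a$ maps $z_{j+1}^S\mapsto z_j^S$ if $\alpha_j=a$, $z_j^S\mapsto z_{j+1}^S$ if $\alpha_j=a^{-1}$, and all other basis vectors to $0$. *Pointed modules.* A pointed module is a pair $(M,m)$ with $M$ a finitely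 presented $\Lambda$-module and $m\in M$; pointed homomorphisms preserve the distinguished elements. The pointed pushout $(M,m)*(N,n)$ is $M\oplus N/\Lambda(m,-n)$, pointed by the class of $(m,0)$. A dense chain of pointed modules is a family $(M_q,m_q)_{q\in C}$ indexed by a non-empty countable dense linearly ordered set $C$ without end points, such that $\mathrm{End}(M_q)$ is local and $m_q\neq0$ for all $q$, there is a pointed homomorphism $(M_q,m_q)\to(M_{q'},m_{q'})$ whenever $q<q'$, and the members are pairwise non-isomorphic as pointed modules. Two dense chains $(M_q,m_q)_{q\in C_1}$, $(N_t,n_t)_{t\in C_2}$ form an independent pair if $\mathrm{End}(M_q*N_t)$ is always local and $(M_q,m_q)*(N_t,n_t)$ is not isomorphic, as a pointed module, to $(M_{q'},m_{q'})*(N_t,n_t)$ or to $(M_q,m_q)*(N_{t'},n_{t'})$ when $q\ne q'$, $t\neq t'$. The independent pair is non-symmetric with respect to $g$ if ${}^gM_{q_1}\not\cong M_{q_2}$, ${}^gN_{t_1}\not\cong N_{t_2}$ and ${}^g(M_{q_1}*N_{t_1})\not\cong M_{q_2}*N_{t_2}$ as modules, for all indices. **Theorem.** Let $U=\bar a_3\bar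 a_1\bar a_2^{-1}$ and $V=\bar a_3\bar a_1\bar b_2\bar c_2\bar c_3^{-1}\bar b_3^{-1}\bar a_1\bar a_2^{-1}$. Then $(V,U)$ and $(V^{-1},U^{-1})$ are $Q$-generating pairs of bands over $\Lambda$. All non-empty words in $\Sigma(U,V)$ and in $\Sigma(U^{-1},V^{-1})$ are strings, and so is $Y^{-1}X$ for all non-empty $X\in\Sigma(U,V)$, $Y\in\Sigma(U^{-1},V^{-1})$. For all $S,T\in\Sigma(U,V)$ and $S',T'\in\Sigma(U^{-1},V^{-1})$ the families $$\big((M(X),z_1^X)_{X\in L^T_S(V,U)},\ (M(Y),z_1^Y)_{Y\in L^{T'}_{S'}(V^{-1},U^{-1})}\big),$$ where both index sets carry the order opposite to the order $<$ of strings, form an independent pair of dense chains of pointed $\Lambda$-modules, and this pair is non-symmetric with respect to $g$. Moreover: 1. ${}^gM(S_1)\ncong M(S_2)$ for all non-empty $S_1,S_2\in\Sigma(U,V)$; 2. ${}^gM(T_1)\ncong M(T_2)$ for all non-empty $T_1,T_2\in\Sigma(U^{-1},V^{-1})$; 3. ${}^gM(T_1^{-1}S_1)\ncong M(T_2^{-1}S_2)$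 for all non-empty $S_1,S_2\in\Sigma(U,V)$ and $T_1,T_2\in\Sigma(U^{-1},V^{-1})$. -/

import Mathlib

universe u v

/-! Pointed modules over a ring, dense chains and independent pairs.
All modules are left modules. -/

/-- An `R`-module with a distinguished element, that is, an `R`-module `M` together with
the homomorphism `R → M` sending `1` to `pt`. -/
structure PointedModule (R : Type u) [Ring R] where
  carrier : Type v
  [addCommGroup : AddCommGroup carrier]
  [module : Module R carrier]
  pt : carrier

namespace PointedModule

attribute [instance] PointedModule.addCommGroup PointedModule.module

variable {R : Type u} [Ring R]

/-- There is a pointed homomorphism `M → N`. -/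
def HasHom (M N : PointedModule.{u, v} R) : Prop :=
  ∃ f : M.carrier →ₗ[R] N.carrier, f M.pt = N.pt

/-- There is a pointed isomorphism `M → N`. -/
def IsIso (M N : PointedModule.{u, v} R) : Prop :=
  ∃ f : M.carrier ≃ₗ[R] N.carrier, f M.pt = N.pt

/-- The pointed pushout `M ∗ N = (M ⊕ N) / {(r m, - r n) : r ∈ R}`, pointed by the class of
`(m, 0)`, which is also the class of `(0, n)`. -/
def pushout (M N : PointedModule.{u, v} R) : PointedModule.{u, v} R where
  carrier := (M.carrier × N.carrier) ⧸ Submodule.span R {((M.pt, -N.pt) : M.carrier × N.carrier)}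
  pt := Submodule.Quotient.mk ((M.pt, 0) : M.carrier × N.carrier)

end PointedModule

/-- The strict order `lt` makes `C` a chain isomorphic to the rationals: a non-empty countable
dense chain without end points. -/
structure IsQChain {C : Type v} (lt : C → C → Prop) : Prop where
  strictTotal : IsStrictTotalOrder C lt
  nonempty : Nonempty C
  countable : Countable C
  dense : ∀ x y, lt x y → ∃ z, lt x z ∧ lt z y
  noMin : ∀ x, ∃ y, lt y x
  noMax : ∀ x, ∃ y, lt x y

/-- A dense chain of pointed (finitely presented) modules, indexed by the chain `(C, lt)`. -/
structure IsDenseChain {R : Type u} [Ring R] {C : Type*} (lt : C → C → Prop)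
    (M : C → PointedModule.{u, v} R) : Prop where
  chain : IsQChain lt
  finitelyPresented : ∀ q, Module.FinitePresentation R (M q).carrier
  localEnd : ∀ q, IsLocalRing (Module.End R (M q).carrier)
  pt_ne_zero : ∀ q, (M q).pt ≠ 0
  hom : ∀ q q', lt q q' → (M q).HasHom (M q')
  not_iso : ∀ q q', q ≠ q' → ¬ (M q).IsIso (M q')

/-- An independent pair of dense chains of pointed modules. -/
structure IsIndependentPair {R : Type u} [Ring R] {C₁ C₂ : Type*}
    (lt₁ : C₁ → C₁ → Prop) (M : C₁ → PointedModule.{u, v} R)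
    (lt₂ : C₂ → C₂ → Prop) (N : C₂ → PointedModule.{u, v} R) : Prop where
  left : IsDenseChain lt₁ M
  right : IsDenseChain lt₂ N
  localEnd : ∀ q t, IsLocalRing (Module.End R ((M q).pushout (N t)).carrier)
  not_iso_left : ∀ q q' t, q ≠ q' → ¬ ((M q).pushout (N t)).IsIso ((M q').pushout (N t))
  not_iso_right : ∀ q t t', t ≠ t' → ¬ ((M q).pushout (N t)).IsIso ((M q).pushout (N t'))

/-- The underlying group of the twist `ᵍM` of a module `M` by a ring automorphism `g`. -/
def Twist {R : Type u} [Ring R] (_g : R ≃+* R) (M : Type v) : Type v := M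

instance {R : Type u} [Ring R] (g : R ≃+* R) (M : Type v) [AddCommGroup M] :
    AddCommGroup (Twist g M) := inferInstanceAs (AddCommGroup M)

/-- On `ᵍM = M ∘ g⁻¹` the element `r` acts as `g⁻¹ r` does on `M`. -/
instance {R : Type u} [Ring R] (g : R ≃+* R) (M : Type v) [AddCommGroup M] [Module R M] :
    Module R (Twist g M) := Module.compHom M (g.symm : R →+* R)

/-- A non-symmetric independent pair with respect to the automorphism `g`. -/
structure IsNonSymmetricPair {R : Type u} [Ring R] (g : R ≃+* R) {C₁ C₂ : Type*}
    (lt₁ : C₁ → C₁ → Prop) (M : C₁ → PointedModule.{u, v} R)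
    (lt₂ : C₂ → C₂ → Prop) (N : C₂ → PointedModule.{u, v} R) : Prop where
  independent : IsIndependentPair lt₁ M lt₂ N
  left : ∀ q₁ q₂, IsEmpty (Twist g (M q₁).carrier ≃ₗ[R] (M q₂).carrier)
  right : ∀ t₁ t₂, IsEmpty (Twist g (N t₁).carrier ≃ₗ[R] (N t₂).carrier)
  pushout : ∀ q₁ t₁ q₂ t₂, IsEmpty
    (Twist g ((M q₁).pushout (N t₁)).carrier ≃ₗ[R] ((M q₂).pushout (N t₂)).carrier)

namespace FivePunctures

/-! The bound quiver. -/

/-- The vertices; `w1, w3, w5` are the primed vertices `1', 3', 5'`. -/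
inductive Vertex
  | v1 | v2 | v3 | v4 | v5 | v6 | w1 | w3 | w5
  deriving DecidableEq

inductive Arrow
  | a1 | a2 | a3 | b1 | b2 | b3 | c1 | c2 | c3
  | a1' | a2' | a3' | b1' | b2' | b3' | c1' | c2' | c3'
  deriving DecidableEq

open Vertex Arrow

instance : Fintype Vertex :=
  ⟨{v1, v2, v3, v4, v5, v6, w1, w3, w5}, by intro x; cases x <;> decide⟩

instance : Fintype Arrow :=
  ⟨{a1, a2, a3, b1, b2, b3, c1, c2, c3, a1', a2', a3', b1', b2', b3', c1', c2', c3'},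
    by intro x; cases x <;> decide⟩

/-- Source of an arrow. -/
def Arrow.src : Arrow → Vertex
  | a1 => v1 | a2 => v5 | a3 => v5
  | b1 => v3 | b2 => v3 | b3 => v1
  | c1 => v2 | c2 => v4 | c3 => v6
  | a1' => w1 | a2' => w5 | a3' => w5
  | b1' => w3 | b2' => w3 | b3' => w1
  | c1' => v2 | c2' => v4 | c3' => v6

/-- Target of an arrow. -/
def Arrow.tgt : Arrow → Vertex
  | a1 => v3 | a2 => v3 | a3 => v1
  | b1 => v2 | b2 => v4 | b3 => v6
  | c1 => v1 | c2 => v5 | c3 => v5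
  | a1' => w3 | a2' => w3 | a3' => w1
  | b1' => v2 | b2' => v4 | b3' => v6
  | c1' => w1 | c2' => w5 | c3' => w5

/-- The generators of the ideal of relations: `(α, β)` stands for the path `αβ`
(first `α`, then `β`). -/
def zeroRelations : List (Arrow × Arrow) :=
  [(a1, b1), (a2, b2), (a3, b3), (b1, c1'), (b2, c2'), (b3, c3'), (c1, a1), (c2, a2), (c3, a3),
   (a1', b1'), (a2', b2'), (a3', b3'), (b1', c1), (b2', c2), (b3', c3),
   (c1', a1'), (c2', a2'), (c3', a3')]

/-- The involution `g` on vertices. -/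
def Vertex.g : Vertex → Vertex
  | v1 => w1 | v3 => w3 | v5 => w5 | w1 => v1 | w3 => v3 | w5 => v5
  | v2 => v2 | v4 => v4 | v6 => v6

/-- The involution `g` on arrows. -/
def Arrow.g : Arrow → Arrow
  | a1 => a1' | a2 => a2' | a3 => a3' | b1 => b1' | b2 => b2' | b3 => b3'
  | c1 => c1' | c2 => c2' | c3 => c3'
  | a1' => a1 | a2' => a2 | a3' => a3 | b1' => b1 | b2' => b2 | b3' => b3
  | c1' => c1 | c2' => c2 | c3' => c3

/-! The algebra. -/

/-- Generators of the algebra: the trivial paths and the arrows. -/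
abbrev Gen := Vertex ⊕ Arrow

/-- The relations of the path algebra of the quiver (the trivial paths are orthogonal idempotents
with sum `1`, and an arrow `a` satisfies `e_{s(a)} a = a = a e_{t(a)}`, so that `αβ` is
the path `α` followed by `β`), and the zero relations. -/
inductive AlgRel (K : Type u) [Field K] : FreeAlgebra K Gen → FreeAlgebra K Gen → Prop
  | idem (x : Vertex) : AlgRel K
      (FreeAlgebra.ι K (Sum.inl x) * FreeAlgebra.ι K (Sum.inl x)) (FreeAlgebra.ι K (Sum.inl x))
  | orth (x y : Vertex) (h : x ≠ y) : AlgRel K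
      (FreeAlgebra.ι K (Sum.inl x) * FreeAlgebra.ι K (Sum.inl y)) 0
  | one : AlgRel K (∑ x : Vertex, FreeAlgebra.ι K (Sum.inl x)) 1
  | src (a : Arrow) : AlgRel K
      (FreeAlgebra.ι K (Sum.inl a.src) * FreeAlgebra.ι K (Sum.inr a)) (FreeAlgebra.ι K (Sum.inr a))
  | tgt (a : Arrow) : AlgRel K
      (FreeAlgebra.ι K (Sum.inr a) * FreeAlgebra.ι K (Sum.inl a.tgt)) (FreeAlgebra.ι K (Sum.inr a))
  | zero (a b : Arrow) (h : (a, b) ∈ zeroRelations) : AlgRel K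
      (FreeAlgebra.ι K (Sum.inr a) * FreeAlgebra.ι K (Sum.inr b)) 0

/-- The algebra `Λ`: the path algebra modulo the ideal generated by the zero relations. -/
abbrev Lam (K : Type u) [Field K] : Type u := RingQuot (AlgRel K)

/-- The class in `Λ` of a generator. -/
def gen (K : Type u) [Field K] (x : Gen) : Lam K :=
  RingQuot.mkAlgHom K (AlgRel K) (FreeAlgebra.ι K x)

theorem gen_rel (K : Type u) [Field K] {x y : FreeAlgebra K Gen} (h : AlgRel K x y) :
    RingQuot.mkAlgHom K (AlgRel K) x = RingQuot.mkAlgHom K (AlgRel K) y :=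
  RingQuot.mkAlgHom_rel K h

/-- The algebra homomorphism `Λ → B` given by values on the generators that satisfy the
relations. -/
def lift (K : Type u) [Field K] {B : Type*} [Ring B] [Algebra K B] (e : Vertex → B) (x : Arrow → B)
    (idem : ∀ v, e v * e v = e v) (orth : ∀ v w, v ≠ w → e v * e w = 0) (one : ∑ v, e v = 1)
    (src : ∀ a : Arrow, e a.src * x a = x a) (tgt : ∀ a : Arrow, x a * e a.tgt = x a)
    (zero : ∀ a b, (a, b) ∈ zeroRelations → x a * x b = 0) : Lam K →ₐ[K] B :=
  RingQuot.liftAlgHom K ⟨FreeAlgebra.lift K (Sum.elim e x), by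
    intro p q h
    induction h with
    | idem v => simpa using idem v
    | orth v w h => simpa using orth v w h
    | one => simpa using one
    | src a => simpa using src a
    | tgt a => simpa using tgt a
    | zero a b h => simpa using zero a b h⟩

theorem lift_gen (K : Type u) [Field K] {B : Type*} [Ring B] [Algebra K B]
    (e : Vertex → B) (x : Arrow → B) (h1 h2 h3 h4 h5 h6) (y : Gen) :
    lift K e x h1 h2 h3 h4 h5 h6 (gen K y) = Sum.elim e x y := by
  simp [lift, gen]

/-- The endomorphism of `Λ` induced by the involution `g` of the quiver. -/
def gHom (K : Type u) [Field K] : Lam K →ₐ[K] Lam K :=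
  lift K (fun v => gen K (Sum.inl v.g)) (fun a => gen K (Sum.inr a.g))
    (fun v => by simpa [gen] using gen_rel K (AlgRel.idem v.g))
    (fun v w h => by
      have h' : v.g ≠ w.g := by revert h; revert v w; decide
      simpa [gen] using gen_rel K (AlgRel.orth _ _ h'))
    (by
      have hs : ∑ v : Vertex, gen K (Sum.inl v.g) = ∑ v : Vertex, gen K (Sum.inl v) :=
        Finset.sum_bijective Vertex.g
          (Function.Involutive.bijective (by intro v; cases v <;> rfl)) (by simp) (by simp)
      rw [hs]
      simpa [gen] using gen_rel K AlgRel.one)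
    (fun a => by
      have h' : a.src.g = a.g.src := by cases a <;> rfl
      rw [h']
      simpa [gen] using gen_rel K (AlgRel.src a.g))
    (fun a => by
      have h' : a.tgt.g = a.g.tgt := by cases a <;> rfl
      rw [h']
      simpa [gen] using gen_rel K (AlgRel.tgt a.g))
    (fun a b h => by
      have h' : (a.g, b.g) ∈ zeroRelations := by revert h; revert a b; decide
      simpa [gen] using gen_rel K (AlgRel.zero _ _ h'))

theorem gHom_gHom (K : Type u) [Field K] : (gHom K).comp (gHom K) = AlgHom.id K (Lam K) := by
  apply RingQuot.ringQuot_ext'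
  apply FreeAlgebra.hom_ext
  funext y
  change gHom K (gHom K (gen K y)) = gen K y
  rcases y with v | a
  · simp only [gHom, lift_gen, Sum.elim_inl]
    cases v <;> rfl
  · simp only [gHom, lift_gen, Sum.elim_inr]
    cases a <;> rfl

/-- The automorphism `g` of `Λ`, which generates the action of `ℤ/2`. -/
def gAut (K : Type u) [Field K] : Lam K ≃+* Lam K :=
  (AlgEquiv.ofAlgHom (gHom K) (gHom K) (gHom_gHom K) (gHom_gHom K)).toRingEquiv

/-! Words, strings and bands. -/

/-- Direct letters `a` and inverse letters `a⁻¹`. -/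
inductive Letter
  | dir (a : Arrow)
  | inv (a : Arrow)
  deriving DecidableEq

namespace Letter

def src : Letter → Vertex
  | dir a => a.src
  | inv a => a.tgt

def tgt : Letter → Vertex
  | dir a => a.tgt
  | inv a => a.src

/-- The formal inverse of a letter. -/
def op : Letter → Letter
  | dir a => inv a
  | inv a => dir a

/-- `x y` or its inverse is a zero relation. -/
def IsZeroPair : Letter → Letter → Prop
  | dir a, dir b => (a, b) ∈ zeroRelations
  | inv a, inv b => (b, a) ∈ zeroRelations
  | _, _ => False

end Letter

abbrev Word := List Letter

/-- The inverse of a word. -/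
def wordInv (w : Word) : Word := (w.map Letter.op).reverse

/-- A (non-trivial) string: consecutive letters are composable and are not inverse to each other,
and neither the word nor its inverse contains a zero relation. -/
def IsString (w : Word) : Prop :=
  w ≠ [] ∧ List.IsChain (fun x y => x.tgt = y.src ∧ x ≠ y.op ∧ ¬ x.IsZeroPair y) w

/-- The power `w ^ m`. -/
def wordPow (w : Word) (m : ℕ) : Word := (List.replicate m w).flatten

/-- A band: a cyclic string all of whose powers are strings, and which is not a proper power. -/
def IsBand (b : Word) : Prop :=
  IsString b ∧ (∀ x ∈ b.getLast?, ∀ y ∈ b.head?, x.tgt = y.src) ∧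
    (∀ m : ℕ, 1 ≤ m → IsString (wordPow b m)) ∧
    ¬ ∃ (c : Word) (m : ℕ), 2 ≤ m ∧ IsString c ∧ b = wordPow c m

/-- The order on the strings with a given first letter. -/
def StringLT (S T : Word) : Prop :=
  (∃ (φ : Arrow) (X : Word), T = S ++ Letter.inv φ :: X) ∨
  (∃ (ψ : Arrow) (X : Word), S = T ++ Letter.dir ψ :: X) ∨
  (∃ (P : Word) (φ ψ : Arrow) (W X : Word),
    S = P ++ Letter.dir ψ :: W ∧ T = P ++ Letter.inv φ :: X)

/-- A `Q`-generating pair of bands. -/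
structure IsQGenerating (U V : Word) : Prop where
  band_left : IsBand U
  band_right : IsBand V
  ne : U ≠ V
  first : ∃ a : Arrow, U.head? = some (Letter.dir a) ∧ V.head? = some (Letter.dir a)
  last : ∃ b : Arrow, U.getLast? = some (Letter.inv b) ∧ V.getLast? = some (Letter.inv b)
  lt : StringLT U V
  not_prolongation_left : ¬ ∃ X : Word, U = V ++ X
  not_prolongation_right : ¬ ∃ Y : Word, V = U ++ Y

/-- `Σ(U, V)`: the finite words over the alphabet `{U, V}`, including the empty one. -/
def Sig (U V : Word) : Set Word :=
  {w | ∃ l : List Word, (∀ x ∈ l, x = U ∨ x = V) ∧ w = l.flatten}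

/-- `L_S^T(U, V) = {S X T U : X ∈ Σ(U, V)}`. -/
def LSet (S T U V : Word) : Set Word :=
  {w | ∃ X ∈ Sig U V, w = S ++ X ++ T ++ U}

/-! String modules. -/

/-- A string `α_0 ⋯ α_{n-1}`, bundled with the proof that it is one. -/
abbrev StringWord := {w : Word // IsString w}

/-- The vertex at position `j` of a string: the source of `α_j` if `j < n`, and
the target of the last letter if `j = n`. -/
def StringWord.vertex (S : StringWord) (j : ℕ) : Vertex :=
  match S.1[j]? with
  | some x => x.src
  | none => (S.1.getLast S.2.1).tgt

/-- The underlying `K`-vector space of the string module of `S`, with basis `z_0, …, z_n`. -/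
def StringModule (K : Type u) (S : StringWord) : Type u := Fin (S.1.length + 1) → K

instance (K : Type u) [Field K] (S : StringWord) : AddCommGroup (StringModule K S) :=
  inferInstanceAs (AddCommGroup (Fin (S.1.length + 1) → K))

instance (K : Type u) [Field K] (S : StringWord) : Module K (StringModule K S) :=
  inferInstanceAs (Module K (Fin (S.1.length + 1) → K))

/-- The canonical basis vector `z_j`. -/
def StringModule.z (K : Type u) [Field K] (S : StringWord) (j : Fin (S.1.length + 1)) :
    StringModule K S := (Pi.single j 1 : Fin (S.1.length + 1) → K)

/-- The matrix of a trivial path: `e_v z_j = z_j` if `v` is the vertex at position `j`,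
and `0` otherwise. -/
def vertexMatrix (K : Type u) [Field K] (S : StringWord) (v : Vertex) :
    Matrix (Fin (S.1.length + 1)) (Fin (S.1.length + 1)) K :=
  Matrix.diagonal fun j => if S.vertex j = v then 1 else 0

/-- The matrix of an arrow: `a z_{i+1} = z_i` if `α_i = a`, `a z_j = z_{j+1}` if `α_j = a⁻¹`, and
`a z_j = 0` otherwise. -/
def arrowMatrix (K : Type u) [Field K] (S : StringWord) (a : Arrow) :
    Matrix (Fin (S.1.length + 1)) (Fin (S.1.length + 1)) K :=
  Matrix.of fun i j =>
    if (S.1[i.val]? = some (Letter.dir a) ∧ j.val = i.val + 1) ∨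
        (S.1[j.val]? = some (Letter.inv a) ∧ i.val = j.val + 1)
    then 1 else 0

theorem StringWord.isChain_getElem (S : StringWord) {i : ℕ} {x y : Letter}
    (hx : S.1[i]? = some x) (hy : S.1[i + 1]? = some y) :
    x.tgt = y.src ∧ x ≠ y.op ∧ ¬ x.IsZeroPair y := by
  obtain ⟨h1, rfl⟩ := List.getElem?_eq_some_iff.1 hx
  obtain ⟨h2, rfl⟩ := List.getElem?_eq_some_iff.1 hy
  exact List.isChain_iff_getElem.1 S.2.2 i h2

theorem StringWord.vertex_left (S : StringWord) {i : ℕ} {x : Letter} (hx : S.1[i]? = some x) :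
    S.vertex i = x.src := by
  simp [StringWord.vertex, hx]

theorem StringWord.vertex_right (S : StringWord) {i : ℕ} {x : Letter} (hx : S.1[i]? = some x) :
    S.vertex (i + 1) = x.tgt := by
  unfold StringWord.vertex
  rcases hy : S.1[i + 1]? with _ | y
  · obtain ⟨h1, rfl⟩ := List.getElem?_eq_some_iff.1 hx
    have h2 : S.1.length ≤ i + 1 := List.getElem?_eq_none_iff.1 hy
    have h3 : i = S.1.length - 1 := by omega
    subst h3
    simp [List.getLast_eq_getElem]
  · exact (S.isChain_getElem hx hy).1.symm

theorem arrowMatrix_ne_zero {K : Type u} [Field K] {S : StringWord} {a : Arrow}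
    {i j : Fin (S.1.length + 1)} (h : arrowMatrix K S a i j ≠ 0) :
    (S.1[i.val]? = some (Letter.dir a) ∧ j.val = i.val + 1) ∨
        (S.1[j.val]? = some (Letter.inv a) ∧ i.val = j.val + 1) := by
  by_contra h'
  exact h (by simp only [arrowMatrix, Matrix.of_apply]; exact if_neg h')

theorem arrowMatrix_vertex {K : Type u} [Field K] {S : StringWord} {a : Arrow}
    {i j : Fin (S.1.length + 1)} (h : arrowMatrix K S a i j ≠ 0) :
    S.vertex i = a.src ∧ S.vertex j = a.tgt := by
  rcases arrowMatrix_ne_zero h with ⟨h1, h2⟩ | ⟨h1, h2⟩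
  · rw [h2]; exact ⟨S.vertex_left h1, S.vertex_right h1⟩
  · rw [h2]; exact ⟨S.vertex_right h1, S.vertex_left h1⟩

theorem arrowMatrix_mul {K : Type u} [Field K] {S : StringWord} {a b : Arrow}
    (h : (a, b) ∈ zeroRelations) : arrowMatrix K S a * arrowMatrix K S b = 0 := by
  ext i k
  rw [Matrix.mul_apply, Matrix.zero_apply]
  refine Finset.sum_eq_zero fun j _ => ?_
  by_contra hne
  rcases arrowMatrix_ne_zero (left_ne_zero_of_mul hne) with ⟨h1, h2⟩ | ⟨h1, h2⟩ <;>
    rcases arrowMatrix_ne_zero (right_ne_zero_of_mul hne) with ⟨h3, h4⟩ | ⟨h3, h4⟩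
  · rw [h2] at h3
    exact (S.isChain_getElem h1 h3).2.2 h
  · have h5 : i.val = k.val := by omega
    rw [h5, h3] at h1
    simp at h1
  · rw [h3] at h1
    simp at h1
  · rw [h4] at h1
    exact (S.isChain_getElem h3 h1).2.2 h

theorem vertexMatrix_idem (K : Type u) [Field K] (S : StringWord) (v : Vertex) :
    vertexMatrix K S v * vertexMatrix K S v = vertexMatrix K S v := by
  simp [vertexMatrix]

theorem vertexMatrix_orth (K : Type u) [Field K] (S : StringWord) (v w : Vertex) (h : v ≠ w) :
    vertexMatrix K S v * vertexMatrix K S w = 0 := by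
  rw [vertexMatrix, vertexMatrix, Matrix.diagonal_mul_diagonal, ← Matrix.diagonal_zero]
  congr 1
  funext j
  by_cases hj : S.vertex j = v
  · simp [hj, h]
  · simp [hj]

theorem vertexMatrix_sum (K : Type u) [Field K] (S : StringWord) :
    ∑ v : Vertex, vertexMatrix K S v = 1 := by
  ext i j
  rw [Matrix.sum_apply]
  by_cases hij : i = j
  · subst hij; simp [vertexMatrix]
  · simp [vertexMatrix, hij]

theorem vertexMatrix_src (K : Type u) [Field K] (S : StringWord) (a : Arrow) :
    vertexMatrix K S a.src * arrowMatrix K S a = arrowMatrix K S a := by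
  ext i j
  rw [vertexMatrix, Matrix.diagonal_mul]
  by_cases h : arrowMatrix K S a i j = 0
  · simp [h]
  · simp [(arrowMatrix_vertex h).1]

theorem vertexMatrix_tgt (K : Type u) [Field K] (S : StringWord) (a : Arrow) :
    arrowMatrix K S a * vertexMatrix K S a.tgt = arrowMatrix K S a := by
  ext i j
  rw [vertexMatrix, Matrix.mul_diagonal]
  by_cases h : arrowMatrix K S a i j = 0
  · simp [h]
  · simp [(arrowMatrix_vertex h).2]

/-- The matrix representation of `Λ` on the string module of `S`. -/
def stringRep (K : Type u) [Field K] (S : StringWord) :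
    Lam K →ₐ[K] Matrix (Fin (S.1.length + 1)) (Fin (S.1.length + 1)) K :=
  lift K (vertexMatrix K S) (arrowMatrix K S) (vertexMatrix_idem K S) (vertexMatrix_orth K S)
    (vertexMatrix_sum K S) (vertexMatrix_src K S) (vertexMatrix_tgt K S)
    (fun _ _ h => arrowMatrix_mul h)

/-- The string module `M(S)`: a left `Λ`-module. -/
instance (K : Type u) [Field K] (S : StringWord) : Module (Lam K) (StringModule K S) :=
  Module.compHom (Fin (S.1.length + 1) → K) ((Matrix.toLinAlgEquiv' :
    Matrix (Fin (S.1.length + 1)) (Fin (S.1.length + 1)) K ≃ₐ[K]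
      Module.End K (Fin (S.1.length + 1) → K)).toAlgHom.comp (stringRep K S)).toRingHom

/-- The canonical pointed string module, pointed by the first canonical basis vector. -/
def canonicalPointed (K : Type u) [Field K] (S : StringWord) : PointedModule.{u, u} (Lam K) where
  carrier := StringModule K S
  pt := StringModule.z K S 0

/-- The index set `L_S^T(U, V)`, as a set of strings. -/
abbrev LIndex (S T U V : Word) := {X : StringWord // X.1 ∈ LSet S T U V}

/-- The chain order used on `L_S^T(U, V)`: the opposite of the order on strings, so that smaller
indices map to larger ones. -/
def LIndex.lt {S T U V : Word} (X Y : LIndex S T U V) : Prop := StringLT Y.1.1 X.1.1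

/-- The family of canonical pointed string modules indexed by `L_S^T(U, V)`. -/
def LFamily (K : Type u) [Field K] (S T U V : Word) (X : LIndex S T U V) :
    PointedModule.{u, u} (Lam K) := canonicalPointed K X.1

/-- The band `a₃ a₁ a₂⁻¹`. -/
def bandU : Word := [.dir a3, .dir a1, .inv a2]

/-- The band `a₃ a₁ b₂ c₂ c₃⁻¹ b₃⁻¹ a₁ a₂⁻¹`. -/
def bandV : Word :=
  [.dir a3, .dir a1, .dir b2, .dir c2, .inv c3, .inv b3, .dir a1, .inv a2]

end FivePunctures

open FivePunctures

namespace FivePunctures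

open Vertex Arrow Letter

/-! ### Modules over `Λ` -/

section Generators

variable {K : Type u} [Field K]

/-! A word in the two bands is encoded by a list of booleans, `true` for `V` and `false` for `U`.
Both bands begin with the same direct letter, and at their first difference `V` has a direct and `U`
an inverse letter; the same holds for `V⁻¹` and `U⁻¹`. So the order of strings is opposite to the
lexicographic order of codes (`IsDirectedPair.stringLT_enc_iff`), and the order properties of the
index sets become statements about lists ending in `true` (`isQChain_LIndex`).

Every module that occurs is the string module of a word `enc bandV bandU l`, pointed at a boundary
between bands (`Realizes`): reversal handles words in the inverse bands, and the pushout of `M(X)`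
and `M(Y)` is `M(Y⁻¹X)` pointed at the junction (`exists_pushout_equiv`). Each band defines a linear
relation `BandRel` on every module, and homomorphisms preserve it. In a string module, the relation
of the band in block `j` equates the coordinates at the two ends of that block, whereas the
`V`-relation forces both to vanish at a `U`-block. Hence a non-zero coefficient of a homomorphism
between two boundaries yields lexicographic inequalities between the words to their right
(`drop_le_of_coord_ne_zero`) and the reversed words to their left (`take_le_of_coord_ne_zero`).

This has two consequences. Homomorphisms in both directions that match boundary points force equal
codes (`code_eq_of_hom`), which settles the pointed non-isomorphisms. An endomorphism is triangular
on the span of the boundaries, with constant diagonal; if the diagonal is non-zero it is injective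
there, and then everywhere, because arrows carry kernel elements into that span. By finite dimension
`f` or `1 - f` is invertible (`isLocalRing_end`).

The homomorphisms within a chain are graph maps along common prefixes (`hasHom_of_stringLT`).
Non-symmetry holds because `a1` acts non-trivially on all these modules while `a1'` annihilates
them. -/

theorem Lam.induction {P : Lam K → Prop} (hK : ∀ c : K, P (algebraMap K (Lam K) c))
    (hgen : ∀ y : Gen, P (gen K y)) (hmul : ∀ a b, P a → P b → P (a * b))
    (hadd : ∀ a b, P a → P b → P (a + b)) (r : Lam K) : P r := by
  obtain ⟨x, rfl⟩ := RingQuot.mkAlgHom_surjective K (AlgRel K) r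
  induction x using FreeAlgebra.induction with
  | grade0 c => rw [AlgHom.commutes]; exact hK c
  | grade1 y => exact hgen y
  | mul a b ha hb => rw [map_mul]; exact hmul _ _ ha hb
  | add a b ha hb => rw [map_add]; exact hadd _ _ ha hb

theorem sum_gen_vertex : ∑ v : Vertex, gen K (Sum.inl v) = 1 := by
  simpa [gen] using gen_rel K AlgRel.one

/-- The vertex components of an element determine it. -/
theorem eq_zero_of_vertex {M : Type*} [AddCommGroup M] [Module (Lam K) M] {m : M}
    (h : ∀ v : Vertex, gen K (Sum.inl v) • m = 0) : m = 0 := by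
  rw [← one_smul (Lam K) m, ← sum_gen_vertex, Finset.sum_smul]
  exact Finset.sum_eq_zero fun v _ => h v

theorem gAut_symm_gen_arrow (a : Arrow) :
    (gAut K).symm (gen K (Sum.inr a)) = gen K (Sum.inr a.g) := by
  change gHom K (gen K (Sum.inr a)) = _
  rw [gHom, lift_gen, Sum.elim_inr]

/-- If an arrow acts non-trivially on `M` and its image under `g` annihilates `N`, then
the twist of `M` is not isomorphic to `N`. -/
theorem isEmpty_twist_linearEquiv {M N : Type*} [AddCommGroup M]
    [Module (Lam K) M] [AddCommGroup N] [Module (Lam K) N] {a : Arrow}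
    (hM : ∃ m : M, gen K (Sum.inr a) • m ≠ 0)
    (hN : ∀ n : N, gen K (Sum.inr a.g) • n = 0) :
    IsEmpty (Twist (gAut K) M ≃ₗ[Lam K] N) := by
  refine ⟨fun f => ?_⟩
  obtain ⟨m, hm⟩ := hM
  let m' : Twist (gAut K) M := m
  have h1 : gen K (Sum.inr a.g) • m' = (gen K (Sum.inr a) • m : M) := by
    change (gAut K).symm (gen K (Sum.inr a.g)) • m = _
    rw [gAut_symm_gen_arrow]
    cases a <;> rfl
  have h2 : f (gen K (Sum.inr a.g) • m') = 0 := by rw [map_smul, hN]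
  rw [LinearEquiv.map_eq_zero_iff] at h2
  exact hm (h1.symm.trans h2)

variable {M N : Type*} [AddCommGroup M] [Module K M] [Module (Lam K) M]
  [IsScalarTower K (Lam K) M] [AddCommGroup N] [Module K N] [Module (Lam K) N]
  [IsScalarTower K (Lam K) N]

/-- A `K`-linear map commuting with the generators of `Λ` is `Λ`-linear. -/
def lamLinear (f : M →ₗ[K] N) (hf : ∀ (y : Gen) (m : M), f (gen K y • m) = gen K y • f m) :
    M →ₗ[Lam K] N where
  toFun := f
  map_add' := map_add f
  map_smul' r m := by
    simp only [RingHom.id_apply]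
    induction r using Lam.induction generalizing m with
    | hK c => rw [algebraMap_smul, algebraMap_smul, map_smul]
    | hgen y => exact hf y m
    | hmul a b ha hb => rw [mul_smul, ha, hb, mul_smul]
    | hadd a b ha hb => rw [add_smul, map_add, ha, hb, add_smul]

/-- A finite-dimensional `Λ`-module is finitely presented. -/
theorem finitePresentation_of_basis {ι : Type*} [Fintype ι] (b : Module.Basis ι K M) :
    Module.FinitePresentation (Lam K) M := by
  classical
  let σ : M →ₗ[K] (ι → Lam K) :=
    b.constr K fun i => (Pi.single i 1 : ι → Lam K)
  let π : (ι → Lam K) →ₗ[Lam K] M := Fintype.linearCombination (Lam K) b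
  have hσ (i) : σ (b i) = Pi.single i 1 := b.constr_basis K _ i
  have hπ (i) : π (Pi.single i 1) = b i := by
    simp [π, Fintype.linearCombination_apply_single]
  have hπσ (m : M) : π (σ m) = m := by
    have : (π.restrictScalars K) ∘ₗ σ = LinearMap.id := b.ext fun i => by simp [hσ, hπ]
    exact LinearMap.congr_fun this m
  refine Module.finitePresentation_of_free_of_surjective π (fun m => ⟨σ m, hπσ m⟩) ?_
  -- These elements measure how far the `K`-linear section `σ` is from commuting with the
  -- generators. There are finitely many of them, and they generate the kernel.
  let s : Gen × ι → (ι → Lam K) := fun p => gen K p.1 • σ (b p.2) - σ (gen K p.1 • b p.2)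
  refine Submodule.fg_def.2 ⟨Set.range s, Set.finite_range s, le_antisymm ?_ ?_⟩
  · rw [Submodule.span_le]
    rintro _ ⟨p, rfl⟩
    simp [s, hπσ]
  · set N := Submodule.span (Lam K) (Set.range s) with hN
    have hgen (y : Gen) (m : M) : gen K y • σ m - σ (gen K y • m) ∈ N := by
      induction b.mem_span m using Submodule.span_induction with
      | zero => simp
      | add x y _ _ hx hy =>
        simp only [map_add, smul_add]
        rw [add_sub_add_comm]
        exact N.add_mem hx hy
      | smul c x _ hx =>
        have := (N.restrictScalars K).smul_mem c hx
        rw [smul_sub, ← map_smul σ, smul_comm c (gen K y) x, smul_comm c (gen K y), ← map_smul σ]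
          at this
        exact this
      | mem _ h =>
        obtain ⟨i, rfl⟩ := h
        exact Submodule.subset_span ⟨(y, i), rfl⟩
    have hall (r : Lam K) (m : M) : r • σ m - σ (r • m) ∈ N := by
      induction r using Lam.induction generalizing m with
      | hK c => simp
      | hgen y => exact hgen y m
      | hmul a b ha hb =>
        have := N.add_mem (N.smul_mem a (hb m)) (ha (b • m))
        rwa [smul_sub, ← mul_smul, ← mul_smul, sub_add_sub_cancel] at this
      | hadd a b ha hb =>
        rw [add_smul, add_smul, map_add, add_sub_add_comm]
        exact N.add_mem (ha m) (hb m)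
    intro c hc
    have hc' : π c = ∑ i, c i • b i := Fintype.linearCombination_apply _ _ _
    -- The subtracted terms add up to `σ (π c) = 0`, so a kernel element is a sum of defects already
    -- known to lie in `N`.
    have h2 : c = ∑ i, (c i • σ (b i) - σ (c i • b i)) := by
      rw [Finset.sum_sub_distrib, ← map_sum σ, ← hc', LinearMap.mem_ker.1 hc, map_zero, sub_zero]
      funext j
      simp [hσ, Finset.sum_apply, Pi.single_apply]
    rw [h2]
    exact N.sum_mem fun i _ => hall _ _

end Generators

/-! ### Coordinates of string modules -/

section Coordinates

variable {K : Type u} [Field K] {S : StringWord}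

instance : IsScalarTower K (Lam K) (StringModule K S) where
  smul_assoc c r m := by
    change Matrix.toLin' (stringRep K S (c • r)) m = c • Matrix.toLin' (stringRep K S r) m
    rw [map_smul, map_smul]
    rfl

/-- The basis `z_0, …, z_n` of a string module. -/
noncomputable def StringModule.basis (K : Type u) [Field K] (S : StringWord) :
    Module.Basis (Fin (S.1.length + 1)) K (StringModule K S) :=
  Pi.basisFun K (Fin (S.1.length + 1))

instance : FiniteDimensional K (StringModule K S) :=
  Module.Basis.finiteDimensional_of_finite (StringModule.basis K S)

theorem finitePresentation_stringModule (K : Type u) [Field K] (S : StringWord) :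
    Module.FinitePresentation (Lam K) (StringModule K S) :=
  finitePresentation_of_basis (StringModule.basis K S)

/-- The `i`-th coordinate, which is `0` for `i` out of range. -/
def coord (i : ℕ) : StringModule K S →ₗ[K] K where
  toFun m := if h : i < S.1.length + 1 then (m : Fin (S.1.length + 1) → K) ⟨i, h⟩ else 0
  map_add' m m' := by
    split_ifs
    · rfl
    · simp
  map_smul' c m := by
    split_ifs
    · rfl
    · simp

/-- The element with given coordinates. -/
def ofCoord (S : StringWord) (F : ℕ → K) : StringModule K S :=
  fun i : Fin (S.1.length + 1) => F i

theorem coord_ofCoord (F : ℕ → K) (i : ℕ) :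
    coord i (ofCoord S F) = if i ≤ S.1.length then F i else 0 := by
  by_cases h : i ≤ S.1.length
  · rw [if_pos h]
    exact dif_pos (Nat.lt_succ_of_le h)
  · rw [if_neg h]
    exact dif_neg (by omega)

theorem coord_eq {m : StringModule K S} {i : ℕ} (h : i < S.1.length + 1) :
    coord i m = (m : Fin (S.1.length + 1) → K) ⟨i, h⟩ :=
  dif_pos h

theorem coord_of_lt {m : StringModule K S} {i : ℕ} (h : S.1.length < i) : coord i m = 0 :=
  dif_neg (by omega)

theorem le_of_coord_ne_zero {m : StringModule K S} {i : ℕ} (h : coord i m ≠ 0) :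
    i ≤ S.1.length := by
  by_contra h'
  exact h (coord_of_lt (by omega))

theorem ext_coord {m m' : StringModule K S} (h : ∀ i ≤ S.1.length, coord i m = coord i m') :
    m = m' := by
  have key : ∀ i : Fin (S.1.length + 1), (m : Fin (S.1.length + 1) → K) i = m' i := fun i => by
    have := h i (Nat.le_of_lt_succ i.2)
    change dite _ _ _ = dite _ _ _ at this
    rwa [dif_pos i.2, dif_pos i.2] at this
  exact funext key

/-- The basis vector `z_j`, which is `0` for `j` out of range. -/
def basisVec (K : Type u) [Field K] (S : StringWord) (j : ℕ) : StringModule K S :=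
  ofCoord S fun i => if i = j then 1 else 0

theorem coord_basisVec {i j : ℕ} (hj : j ≤ S.1.length) :
    coord i (basisVec K S j) = if i = j then 1 else 0 := by
  rw [basisVec, coord_ofCoord]
  split_ifs <;> first | rfl | omega

theorem z_zero_eq : StringModule.z K S 0 = basisVec K S 0 := by
  refine ext_coord fun i hi => ?_
  rw [coord_basisVec (Nat.zero_le _)]
  change dite _ _ _ = _
  rw [dif_pos (Nat.lt_succ_of_le hi)]
  simp [StringModule.z, Pi.single_apply, Fin.ext_iff]

theorem coord_vertex (v : Vertex) (m : StringModule K S) (i : ℕ) :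
    coord i (gen K (Sum.inl v) • m) = if S.vertex i = v then coord i m else 0 := by
  by_cases hi : i ≤ S.1.length
  · have h0 : stringRep K S (gen K (Sum.inl v)) = vertexMatrix K S v := by
      rw [stringRep, lift_gen, Sum.elim_inl]
    have h1 : gen K (Sum.inl v) • m
        = (Matrix.mulVec (vertexMatrix K S v) (m : Fin (S.1.length + 1) → K)) := by
      change Matrix.toLin' (stringRep K S (gen K (Sum.inl v))) m = _
      rw [h0]
      rfl
    rw [coord_eq (Nat.lt_succ_of_le hi), coord_eq (Nat.lt_succ_of_le hi), h1, vertexMatrix]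
    exact (Matrix.mulVec_diagonal _ _ _).trans (by simp only [ite_mul, one_mul, zero_mul])
  · rw [coord_of_lt (by omega), coord_of_lt (by omega), ite_self]

/-- Row `i` of an arrow matrix can be non-zero only in columns `i + 1` and `i - 1`. The guard `1 ≤
i` disarms the truncated subtraction at `0`. -/
theorem coord_arrow (a : Arrow) (m : StringModule K S) (i : ℕ) :
    coord i (gen K (Sum.inr a) • m) = (if S.1[i]? = some (dir a) then coord (i + 1) m else 0) +
      (if 1 ≤ i ∧ S.1[i - 1]? = some (inv a) then coord (i - 1) m else 0) := by
  by_cases hi : i ≤ S.1.length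
  · have h0 : stringRep K S (gen K (Sum.inr a)) = arrowMatrix K S a := by
      rw [stringRep, lift_gen, Sum.elim_inr]
    have h1 : gen K (Sum.inr a) • m
        = (Matrix.mulVec (arrowMatrix K S a) (m : Fin (S.1.length + 1) → K)) := by
      change Matrix.toLin' (stringRep K S (gen K (Sum.inr a))) m = _
      rw [h0]
      rfl
    have h2 : ∀ j : Fin (S.1.length + 1), arrowMatrix K S a ⟨i, Nat.lt_succ_of_le hi⟩ j =
        (if S.1[i]? = some (dir a) ∧ j.val = i + 1 then 1 else 0) +
        (if S.1[j.val]? = some (inv a) ∧ i = j.val + 1 then 1 else 0) := by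
      intro j
      simp only [arrowMatrix, Matrix.of_apply]
      by_cases c1 : S.1[i]? = some (dir a) ∧ j.val = i + 1
      · have c2 : ¬ (S.1[j.val]? = some (inv a) ∧ i = j.val + 1) := by omega
        rw [if_pos (Or.inl c1), if_pos c1, if_neg c2, add_zero]
      · simp [c1]
    rw [coord_eq (Nat.lt_succ_of_le hi), h1]
    simp only [Matrix.mulVec, dotProduct, h2, add_mul, Finset.sum_add_distrib]
    congr 1
    · by_cases c : S.1[i]? = some (dir a)
      · have hlt : i + 1 < S.1.length + 1 := by
          have := (List.getElem?_eq_some_iff.1 c).1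
          omega
        rw [if_pos c, Finset.sum_eq_single ⟨i + 1, hlt⟩, coord_eq hlt]
        · simp only [c, and_self, if_true, one_mul]
        · intro j _ hj
          rw [if_neg, zero_mul]
          exact fun h => hj (Fin.ext h.2)
        · simp
      · simp [c]
    · by_cases c : 1 ≤ i ∧ S.1[i - 1]? = some (inv a)
      · rw [if_pos c]
        obtain ⟨h3, hj⟩ := c
        obtain ⟨j, rfl⟩ : ∃ j, i = j + 1 := ⟨i - 1, by omega⟩
        rw [Nat.add_sub_cancel] at hj ⊢
        rw [Finset.sum_eq_single ⟨j, by omega⟩, coord_eq (by omega)]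
        · simp only [hj, and_self, if_true, one_mul]
        · intro j' _ hj'
          rw [if_neg, zero_mul]
          exact fun h => hj' (Fin.ext (by simpa using h.2.symm))
        · simp
      · rw [if_neg c]
        refine Finset.sum_eq_zero fun j _ => ?_
        rw [if_neg, zero_mul]
        rintro ⟨h3, rfl⟩
        exact c ⟨by omega, h3⟩
  · rw [coord_of_lt (by omega), if_neg, if_neg, add_zero]
    · rintro ⟨h, hj⟩
      have := (List.getElem?_eq_some_iff.1 hj).1
      omega
    · intro h
      have := (List.getElem?_eq_some_iff.1 h).1
      omega

/-- Strings are reduced, so the two terms of `coord_arrow` never occur together. -/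
theorem StringWord.not_inv_dir {a : Arrow} {i : ℕ} (h : S.1[i]? = some (inv a))
    (h' : S.1[i + 1]? = some (dir a)) : False :=
  (S.isChain_getElem h h').2.1 rfl

theorem StringWord.not_dir_inv {a : Arrow} {i : ℕ} (h : S.1[i]? = some (dir a))
    (h' : S.1[i + 1]? = some (inv a)) : False :=
  (S.isChain_getElem h h').2.1 rfl

theorem coord_arrow_dir {a : Arrow} {i : ℕ} (h : S.1[i]? = some (dir a)) (m : StringModule K S) :
    coord i (gen K (Sum.inr a) • m) = coord (i + 1) m := by
  rw [coord_arrow, if_pos h, if_neg, add_zero]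
  rintro ⟨hi, hj⟩
  obtain ⟨j, rfl⟩ : ∃ j, i = j + 1 := ⟨i - 1, by omega⟩
  exact S.not_inv_dir hj h

theorem coord_arrow_inv {a : Arrow} {i : ℕ} (h : S.1[i]? = some (inv a)) (m : StringModule K S) :
    coord (i + 1) (gen K (Sum.inr a) • m) = coord i m := by
  rw [coord_arrow, if_neg (fun h' => S.not_inv_dir h h'), if_pos ⟨by omega, h⟩, zero_add,
    Nat.add_sub_cancel]

theorem coord_arrow_eq_zero {a : Arrow} {i : ℕ} (h : S.1[i]? ≠ some (dir a))
    (h' : ∀ j, i = j + 1 → S.1[j]? ≠ some (inv a)) (m : StringModule K S) :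
    coord i (gen K (Sum.inr a) • m) = 0 := by
  rw [coord_arrow, if_neg h, if_neg, add_zero]
  rintro ⟨hi, hj⟩
  exact h' (i - 1) (by omega) hj

theorem arrow_basisVec_dir {a : Arrow} {i : ℕ} (h : S.1[i]? = some (dir a)) :
    gen K (Sum.inr a) • basisVec K S (i + 1) = basisVec K S i := by
  have hi := (List.getElem?_eq_some_iff.1 h).1
  refine ext_coord fun j hj => ?_
  rw [coord_basisVec hi.le]
  by_cases c : S.1[j]? = some (dir a)
  · rw [coord_arrow_dir c, coord_basisVec hi]
    simp
  · have hne : j ≠ i := by rintro rfl; exact c h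
    rw [coord_arrow, if_neg c, zero_add, if_neg hne, coord_basisVec hi]
    split_ifs with c' h2
    · rw [h2] at c'
      exact (S.not_dir_inv h c'.2).elim
    · rfl
    · rfl

theorem arrow_basisVec_inv {a : Arrow} {i : ℕ} (h : S.1[i]? = some (inv a)) :
    gen K (Sum.inr a) • basisVec K S i = basisVec K S (i + 1) := by
  have hi := (List.getElem?_eq_some_iff.1 h).1
  refine ext_coord fun j hj => ?_
  rw [coord_basisVec hi, coord_arrow, coord_basisVec hi.le, coord_basisVec hi.le]
  have h1 : j + 1 = i → S.1[j]? ≠ some (dir a) := by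
    rintro rfl c
    exact S.not_dir_inv c h
  by_cases hne : j = i + 1
  · subst hne
    rw [if_neg (fun c => S.not_inv_dir h c), if_pos ⟨by omega, h⟩]
    simp
  · split_ifs with h2 h3 h4 h5 <;> first | rfl | omega | exact (h1 h3 h2).elim | simp

/-- A `Λ`-linear map of string modules, from its effect on coordinates. -/
def coordHom {S T : StringWord} (F : StringModule K S →ₗ[K] StringModule K T)
    (hv : ∀ (v : Vertex) (m : StringModule K S), ∀ i ≤ T.1.length,
      coord i (F (gen K (Sum.inl v) • m)) = if T.vertex i = v then coord i (F m) else 0)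
    (ha : ∀ (a : Arrow) (m : StringModule K S), ∀ i ≤ T.1.length,
      coord i (F (gen K (Sum.inr a) • m)) = coord i (gen K (Sum.inr a) • F m)) :
    StringModule K S →ₗ[Lam K] StringModule K T :=
  lamLinear F (by
    rintro (v | a) m
    · exact ext_coord fun i hi => by rw [hv v m i hi, coord_vertex]
    · exact ext_coord fun i hi => ha a m i hi)

end Coordinates

/-! ### Words in two letters -/

section Words

/-- The word over the alphabet `{A, B}` encoded by a list of booleans: `true` stands for `A` and
`false` for `B`. -/
def enc (A B : Word) (l : List Bool) : Word := (l.map fun b => cond b A B).flatten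

variable {A B : Word}

theorem enc_nil : enc A B [] = [] := rfl

theorem enc_cons (b : Bool) (l : List Bool) : enc A B (b :: l) = cond b A B ++ enc A B l := by
  simp [enc]

theorem enc_append (l l' : List Bool) : enc A B (l ++ l') = enc A B l ++ enc A B l' := by
  simp [enc]

theorem mem_sig_iff {w : Word} : w ∈ Sig A B ↔ ∃ l, w = enc A B l := by
  constructor
  · rintro ⟨L, hL, rfl⟩
    induction L with
    | nil => exact ⟨[], rfl⟩
    | cons x L ih =>
      obtain ⟨l, hl⟩ := ih fun y hy => hL y (List.mem_cons_of_mem _ hy)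
      rcases hL x List.mem_cons_self with h | h
      · exact ⟨true :: l, by rw [enc_cons, ← hl, h]; rfl⟩
      · exact ⟨false :: l, by rw [enc_cons, ← hl, h]; rfl⟩
  · rintro ⟨l, rfl⟩
    refine ⟨l.map fun b => cond b A B, ?_, rfl⟩
    intro x hx
    obtain ⟨b, _, rfl⟩ := List.mem_map.1 hx
    cases b <;> simp

theorem sig_comm (A B : Word) : Sig A B = Sig B A := by
  simp only [Sig, or_comm]

/-- The trailing `A` becomes a final `true` in the code; density and the absence of a minimum rest
on it. -/
theorem mem_LSet_enc_iff {s t : List Bool} {w : Word} :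
    w ∈ LSet (enc A B s) (enc A B t) A B ↔ ∃ x, w = enc A B (s ++ x ++ t ++ [true]) := by
  constructor
  · rintro ⟨X, hX, rfl⟩
    obtain ⟨x, rfl⟩ := mem_sig_iff.1 hX
    exact ⟨x, by simp [enc]⟩
  · rintro ⟨x, rfl⟩
    exact ⟨enc A B x, mem_sig_iff.2 ⟨x, rfl⟩, by simp [enc]⟩

/-- The rank of the letter following a common prefix, or of the end of the word, in the
comparison of strings. -/
def letterRank : Option Letter → ℕ
  | some (dir _) => 0
  | none => 1
  | some (inv _) => 2

/-- The three cases of the order merge into one comparison at the first difference, with direct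
letters below the end of the word and inverse letters above it. Asymmetry is immediate in this form.
-/
theorem StringLT.exists_index {S T : Word} (h : StringLT S T) :
    ∃ i : ℕ, (∀ j < i, S[j]? = T[j]?) ∧ letterRank S[i]? < letterRank T[i]? := by
  rcases h with ⟨φ, X, rfl⟩ | ⟨ψ, X, rfl⟩ | ⟨P, φ, ψ, W, X, rfl, rfl⟩
  · exact ⟨S.length, fun j hj => (List.getElem?_append_left hj).symm, by simp [letterRank]⟩
  · exact ⟨T.length, fun j hj => List.getElem?_append_left hj, by simp [letterRank]⟩
  · refine ⟨P.length, fun j hj => ?_, by simp [letterRank]⟩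
    rw [List.getElem?_append_left hj, List.getElem?_append_left hj]

theorem StringLT.asymm {S T : Word} (h : StringLT S T) : ¬ StringLT T S := by
  intro h'
  obtain ⟨i, hi, hi'⟩ := h.exists_index
  obtain ⟨j, hj, hj'⟩ := h'.exists_index
  rcases lt_trichotomy i j with c | rfl | c
  · rw [hj i c] at hi'
    exact lt_irrefl _ hi'
  · exact lt_asymm hi' hj'
  · rw [hi j c] at hj'
    exact lt_irrefl _ hj'

theorem StringLT.append_left {S T : Word} (h : StringLT S T) (C : Word) :
    StringLT (C ++ S) (C ++ T) := by
  rcases h with ⟨φ, X, rfl⟩ | ⟨ψ, X, rfl⟩ | ⟨P, φ, ψ, W, X, rfl, rfl⟩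
  · exact Or.inl ⟨φ, X, by simp⟩
  · exact Or.inr (Or.inl ⟨ψ, X, by simp⟩)
  · exact Or.inr (Or.inr ⟨C ++ P, φ, ψ, W, X, by simp, by simp⟩)

/-- Two words that begin with direct letters and first differ in a direct letter of `A` and
an inverse letter of `B`. -/
structure IsDirectedPair (A B : Word) : Prop where
  head_left : ∃ a X, A = dir a :: X
  head_right : ∃ a X, B = dir a :: X
  split : ∃ P φ ψ W X, A = P ++ dir ψ :: W ∧ B = P ++ inv φ :: X

namespace IsDirectedPair

/-- Prolonging a word by `A` or `B` appends a direct letter first, so it lowers the string while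
raising the code; likewise `A`, coded by the larger `true`, is the smaller of the two at a first
difference. -/
theorem stringLT_enc (h : IsDirectedPair A B) {l l' : List Bool} (hl : l < l') :
    StringLT (enc A B l') (enc A B l) := by
  induction l generalizing l' with
  | nil =>
    cases l' with
    | nil => exact absurd hl (lt_irrefl _)
    | cons b l' =>
      obtain ⟨a, X, hA⟩ := h.head_left
      obtain ⟨a', X', hB⟩ := h.head_right
      rw [enc_cons, enc_nil]
      cases b
      · exact Or.inr (Or.inl ⟨a', X' ++ enc A B l', by simp [hB]⟩)
      · exact Or.inr (Or.inl ⟨a, X ++ enc A B l', by simp [hA]⟩)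
  | cons b l ih =>
    cases l' with
    | nil => exact absurd hl (List.not_lt_nil _)
    | cons b' l' =>
      rw [enc_cons, enc_cons]
      rcases List.cons_lt_cons_iff.1 hl with hb | ⟨rfl, hl'⟩
      · obtain ⟨rfl, rfl⟩ : b = false ∧ b' = true := by
          clear hl
          revert hb
          revert b b'
          decide
        obtain ⟨P, φ, ψ, W, X, hA, hB⟩ := h.split
        exact Or.inr (Or.inr ⟨P, φ, ψ, W ++ enc A B l', X ++ enc A B l, by simp [hA], by simp [hB]⟩)
      · exact (ih hl').append_left _

theorem stringLT_enc_iff (h : IsDirectedPair A B) {l l' : List Bool} :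
    StringLT (enc A B l') (enc A B l) ↔ l < l' := by
  refine ⟨fun hl => ?_, h.stringLT_enc⟩
  rcases lt_trichotomy l l' with c | rfl | c
  · exact c
  · exact absurd hl hl.asymm
  · exact absurd hl (h.stringLT_enc c).asymm

/-- Distinct codes are comparable, so their words are strictly ordered and hence distinct. -/
theorem enc_injective (h : IsDirectedPair A B) : Function.Injective (enc A B) := by
  intro l l' hl
  rcases lt_trichotomy l l' with c | c | c
  · have := h.stringLT_enc c
    rw [hl] at this
    exact absurd this this.asymm
  · exact c
  · have := h.stringLT_enc c
    rw [hl] at this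
    exact absurd this this.asymm

end IsDirectedPair

/-- The comparison is decided at the first `true` of `w`, before `v` is reached. -/
theorem replicate_false_append_lt {w : List Bool} (hw : true ∈ w) (v : List Bool) :
    List.replicate w.length false ++ v < w := by
  induction w with
  | nil => simp at hw
  | cons b w ih =>
    rw [List.length_cons, List.replicate_succ, List.cons_append, List.cons_lt_cons_iff]
    cases b
    · exact Or.inr ⟨rfl, ih (by simpa using hw)⟩
    · exact Or.inl (by decide)

theorem lt_append_of_ne_nil (x : List Bool) {w : List Bool} (hw : w ≠ []) : x < x ++ w := by
  induction x with
  | nil =>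
    cases w with
    | nil => exact absurd rfl hw
    | cons b w => exact List.nil_lt_cons _ _
  | cons b x ih => exact List.cons_lt_cons_iff.2 (Or.inr ⟨rfl, ih⟩)

theorem append_lt_append_left (x : List Bool) {w w' : List Bool} (h : w < w') :
    x ++ w < x ++ w' := by
  induction x with
  | nil => exact h
  | cons b x ih => exact List.cons_lt_cons_iff.2 (Or.inr ⟨rfl, ih⟩)

/-- In the lexicographic order, `x < y` either because `x` is a proper prefix of `y` or
because of a first difference, which then also separates the extensions of `x` and `y`. -/
theorem exists_append_or_lt_of_lt {x y : List Bool} (h : x < y) :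
    (∃ w, w ≠ [] ∧ y = x ++ w) ∨ ∀ v, x ++ v < y := by
  induction x generalizing y with
  | nil => exact Or.inl ⟨y, by rintro rfl; exact lt_irrefl _ h, rfl⟩
  | cons b x ih =>
    cases y with
    | nil => exact absurd h (List.not_lt_nil _)
    | cons b' y =>
      rcases List.cons_lt_cons_iff.1 h with hb | ⟨rfl, h'⟩
      · exact Or.inr fun v => List.cons_lt_cons_iff.2 (Or.inl hb)
      · rcases ih h' with ⟨w, hw, rfl⟩ | h2
        · exact Or.inl ⟨w, hw, rfl⟩
        · exact Or.inr fun v => List.cons_lt_cons_iff.2 (Or.inr ⟨rfl, h2 v⟩)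

/-- Density of `L_S^T` in terms of codes. -/
theorem exists_code_between {s t x y : List Bool}
    (h : s ++ x ++ t ++ [true] < s ++ y ++ t ++ [true]) :
    ∃ z, s ++ x ++ t ++ [true] < s ++ z ++ t ++ [true] ∧
      s ++ z ++ t ++ [true] < s ++ y ++ t ++ [true] := by
  rcases exists_append_or_lt_of_lt h with ⟨w, hw, hy⟩ | h'
  -- Here the larger code is the smaller one followed by `w`, which ends in `true`. Inserting
  -- `w.length` copies of `false` prolongs the smaller code but stays below `w`, whatever follows.
  · refine ⟨x ++ t ++ [true] ++ List.replicate w.length false, ?_, ?_⟩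
    · have := lt_append_of_ne_nil (s ++ x ++ t ++ [true])
        (w := List.replicate w.length false ++ t ++ [true]) (by simp)
      simpa using this
    · have hmem : true ∈ w := by
        have h1 := congrArg List.getLast? hy
        rw [List.getLast?_append_of_ne_nil _ hw] at h1
        simp only [List.getLast?_append, List.getLast?_singleton, Option.some_or] at h1
        exact List.mem_of_getLast? h1.symm
      rw [hy]
      have := append_lt_append_left (s ++ x ++ t ++ [true])
        (replicate_false_append_lt hmem (t ++ [true]))
      simpa using this
  -- The codes differ at a proper first difference, so every prolongation of the smaller one remains
  -- below the larger.
  · refine ⟨x ++ t ++ [true], ?_, ?_⟩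
    · have := lt_append_of_ne_nil (s ++ x ++ t ++ [true]) (w := t ++ [true]) (by simp)
      simpa using this
    · simpa using h' (t ++ [true])

/-- Passing to codes replaces the index set by the lists `s ++ x ++ t ++ [true]` in lexicographic
order; countability comes from the injection into lists of booleans. -/
theorem isQChain_LIndex (h : IsDirectedPair A B) (hstr : ∀ l ≠ [], IsString (enc A B l))
    (s t : List Bool) :
    IsQChain (LIndex.lt (S := enc A B s) (T := enc A B t) (U := A) (V := B)) := by
  have hcode (X : LIndex (enc A B s) (enc A B t) A B) :
      ∃ x, X.1.1 = enc A B (s ++ x ++ t ++ [true]) := mem_LSet_enc_iff.1 X.2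
  choose code hc using hcode
  have hlt (X Y : LIndex (enc A B s) (enc A B t) A B) :
      LIndex.lt X Y ↔ s ++ code X ++ t ++ [true] < s ++ code Y ++ t ++ [true] := by
    rw [LIndex.lt, hc X, hc Y, h.stringLT_enc_iff]
  have hex (x : List Bool) : ∃ X : LIndex (enc A B s) (enc A B t) A B,
      s ++ code X ++ t ++ [true] = s ++ x ++ t ++ [true] := by
    let X : LIndex (enc A B s) (enc A B t) A B :=
      ⟨⟨enc A B (s ++ x ++ t ++ [true]), hstr _ (by simp)⟩, mem_LSet_enc_iff.2 ⟨x, rfl⟩⟩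
    exact ⟨X, h.enc_injective (hc X).symm⟩
  have hinj : Function.Injective code := by
    intro X Y hXY
    apply Subtype.ext
    apply Subtype.ext
    rw [hc X, hc Y, hXY]
  refine
    { strictTotal :=
        { trichotomous := fun X Y h1 h2 => ?_
          irrefl := fun X => ?_
          trans := fun X Y Z => ?_ }
      nonempty := ⟨(hex []).choose⟩
      countable := hinj.countable
      dense := fun X Y hXY => ?_
      noMin := fun X => ?_
      noMax := fun X => ?_ }
  · rw [hlt] at h1 h2
    have h3 := le_antisymm (not_lt.1 h2) (not_lt.1 h1)
    exact hinj (by simpa using h3)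
  · rw [hlt]
    exact lt_irrefl _
  · rw [hlt, hlt, hlt]
    exact lt_trans
  · rw [hlt] at hXY
    obtain ⟨z, h1, h2⟩ := exists_code_between hXY
    obtain ⟨Z, hZ⟩ := hex z
    exact ⟨Z, by rwa [hlt, hZ], by rwa [hlt, hZ]⟩
  -- Replacing the final `true` by `false` and then closing with `t ++ [true]` goes below `X`.
  · obtain ⟨Y, hY⟩ := hex (code X ++ t ++ [false])
    refine ⟨Y, ?_⟩
    rw [hlt, hY]
    have := append_lt_append_left (s ++ code X ++ t) (w := false :: (t ++ [true])) (w' := [true])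
      (List.cons_lt_cons_iff.2 (Or.inl (by decide)))
    simpa using this
  · obtain ⟨Y, hY⟩ := hex (code X ++ t ++ [true])
    refine ⟨Y, ?_⟩
    rw [hlt, hY]
    have := lt_append_of_ne_nil (s ++ code X ++ t ++ [true]) (w := t ++ [true]) (by simp)
    simpa using this

end Words

/-! ### Strings and bands -/

section Strings

/-- The condition on consecutive letters of a string. -/
abbrev Follows (x y : Letter) : Prop := x.tgt = y.src ∧ x ≠ y.op ∧ ¬ x.IsZeroPair y

instance (x y : Letter) : Decidable (x.IsZeroPair y) := by
  cases x <;> cases y <;> unfold Letter.IsZeroPair <;> infer_instance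

theorem Letter.op_op (x : Letter) : x.op.op = x := by cases x <;> rfl

theorem wordInv_wordInv (w : Word) : wordInv (wordInv w) = w := by
  have h : op ∘ op = id := funext op_op
  simp [wordInv, h]

theorem wordInv_append (w w' : Word) : wordInv (w ++ w') = wordInv w' ++ wordInv w := by
  simp [wordInv]

theorem wordInv_length (w : Word) : (wordInv w).length = w.length := by
  simp [wordInv]

theorem wordInv_enc (A B : Word) (l : List Bool) :
    wordInv (enc A B l) = enc (wordInv A) (wordInv B) l.reverse := by
  induction l with
  | nil => rfl
  | cons b l ih =>
    rw [enc_cons, wordInv_append, ih, List.reverse_cons, enc_append, enc_cons, enc_nil,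
      List.append_nil]
    cases b <;> rfl

theorem follows_op {x y : Letter} : Follows y.op x.op ↔ Follows x y := by
  cases x <;> cases y <;>
    simp [Follows, Letter.op, Letter.src, Letter.tgt, Letter.IsZeroPair, eq_comm]

theorem isString_wordInv {w : Word} : IsString (wordInv w) ↔ IsString w := by
  unfold IsString
  rw [wordInv, List.isChain_reverse, List.isChain_map]
  refine and_congr (by simp) ?_
  exact ⟨fun h => h.imp fun _ _ h => follows_op.1 h, fun h => h.imp fun _ _ h => follows_op.2 h⟩

/-- Both bands begin with `a₃` and end with `a₂⁻¹`, so besides the bands themselves only one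
junction has to be checked. -/
theorem isString_enc {l : List Bool} (hl : l ≠ []) : IsString (enc bandV bandU l) := by
  have hne : ∀ b : Bool, cond b bandV bandU ≠ [] := by decide
  constructor
  · obtain ⟨b, l, rfl⟩ := List.exists_cons_of_ne_nil hl
    rw [enc_cons]
    exact fun h => hne b (List.append_eq_nil_iff.1 h).1
  · refine (List.isChain_flatten ?_).2 ⟨?_, ?_⟩
    · intro h
      obtain ⟨b, _, hb⟩ := List.mem_map.1 h
      exact hne b hb
    · intro w hw
      obtain ⟨b, _, rfl⟩ := List.mem_map.1 hw
      have : ∀ b : Bool, List.IsChain Follows (cond b bandV bandU) := by decide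
      exact this b
    · rw [List.isChain_map]
      have : ∀ b b' : Bool, ∀ x ∈ (cond b bandV bandU).getLast?,
          ∀ y ∈ (cond b' bandV bandU).head?, Follows x y := by
        intro b b' x hx y hy
        have h1 : x = inv a2 := by cases b <;> simpa [bandU, bandV, eq_comm] using hx
        have h2 : y = dir a3 := by cases b' <;> simpa [bandU, bandV, eq_comm] using hy
        subst h1 h2
        decide
      exact List.isChain_iff_getElem.2 fun i hi => this _ _

theorem isString_enc_wordInv {l : List Bool} (hl : l ≠ []) :
    IsString (enc (wordInv bandV) (wordInv bandU) l) := by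
  have h := wordInv_enc bandV bandU l.reverse
  rw [List.reverse_reverse] at h
  rw [← h, isString_wordInv]
  exact isString_enc (by simpa using hl)

/-- In a proper power the first letter would occur at least twice. -/
theorem not_proper_power {w : Word} {x : Letter} (hx : w.head? = some x) (hc : w.count x = 1) :
    ¬ ∃ (c : Word) (m : ℕ), 2 ≤ m ∧ IsString c ∧ w = wordPow c m := by
  rintro ⟨c, m, hm, hs, rfl⟩
  obtain ⟨m, rfl⟩ : ∃ k, m = k + 2 := ⟨m - 2, by omega⟩
  obtain ⟨y, c, rfl⟩ := List.exists_cons_of_ne_nil hs.1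
  simp only [wordPow, List.replicate_succ, List.flatten_cons, List.cons_append,
    List.head?_cons, Option.some.injEq] at hx
  subst hx
  simp only [wordPow, List.replicate_succ, List.flatten_cons, List.count_append,
    List.count_cons_self] at hc
  omega

/-- Powers of `A` or `B` are words with constant code, so `hstr` covers all of them. -/
theorem isBand_of_enc {A B : Word} (hstr : ∀ l ≠ [], IsString (enc A B l)) {x : Letter} (b : Bool)
    (hcyc : ∀ x ∈ (cond b A B).getLast?, ∀ y ∈ (cond b A B).head?, x.tgt = y.src)
    (hx : (cond b A B).head? = some x) (hc : (cond b A B).count x = 1) :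
    IsBand (cond b A B) := by
  have hpow (m : ℕ) : wordPow (cond b A B) m = enc A B (List.replicate m b) := by
    simp [wordPow, enc]
  refine ⟨?_, hcyc, fun m hm => ?_, not_proper_power hx hc⟩
  · have := hstr [b] (by simp)
    rwa [enc_cons, enc_nil, List.append_nil] at this
  · rw [hpow]
    exact hstr _ (by simp; omega)

theorem isDirectedPair_band : IsDirectedPair bandV bandU :=
  ⟨⟨a3, _, rfl⟩, ⟨a3, _, rfl⟩, [dir a3, dir a1], a2, b2, _, _, rfl, rfl⟩

/-- The bands compare in the same direction when read from the right. This is why left and right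
parts of words obey inequalities of the same kind later on. -/
theorem isDirectedPair_wordInv_band : IsDirectedPair (wordInv bandV) (wordInv bandU) :=
  ⟨⟨a2, _, rfl⟩, ⟨a2, _, rfl⟩, [dir a2, inv a1], a3, b3, _, _, rfl, rfl⟩

theorem isQGenerating_band : IsQGenerating bandV bandU where
  band_left := isBand_of_enc (fun _ => isString_enc) true (by decide) rfl (by decide)
  band_right := isBand_of_enc (fun _ => isString_enc) false (by decide) rfl (by decide)
  ne := by decide
  first := ⟨a3, rfl, rfl⟩
  last := ⟨a2, rfl, rfl⟩
  lt := Or.inr (Or.inr ⟨[dir a3, dir a1], a2, b2, _, _, rfl, rfl⟩)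
  not_prolongation_left := by rintro ⟨X, hX⟩; simp [bandU, bandV] at hX
  not_prolongation_right := by rintro ⟨X, hX⟩; simp [bandU, bandV] at hX

theorem isQGenerating_wordInv_band : IsQGenerating (wordInv bandV) (wordInv bandU) where
  band_left := isBand_of_enc (fun _ => isString_enc_wordInv) true (by decide) rfl (by decide)
  band_right := isBand_of_enc (fun _ => isString_enc_wordInv) false (by decide) rfl (by decide)
  ne := by decide
  first := ⟨a2, rfl, rfl⟩
  last := ⟨a3, rfl, rfl⟩
  lt := Or.inr (Or.inr ⟨[dir a2, inv a1], a3, b3, _, _, rfl, rfl⟩)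
  not_prolongation_left := by rintro ⟨X, hX⟩; simp [wordInv, op, bandU, bandV] at hX
  not_prolongation_right := by rintro ⟨X, hX⟩; simp [wordInv, op, bandU, bandV] at hX

end Strings

/-! ### String modules of words in the two bands -/

section Blocks

/-- The band encoded by a boolean. -/
abbrev band (b : Bool) : Word := cond b bandV bandU

/-- The position at which the `j`-th band begins in a word in the two bands. -/
def offset (l : List Bool) (j : ℕ) : ℕ := (enc bandV bandU (l.take j)).length

theorem offset_zero (l : List Bool) : offset l 0 = 0 := rfl

theorem offset_length (l : List Bool) : offset l l.length = (enc bandV bandU l).length := by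
  rw [offset, List.take_length]

theorem offset_succ {l : List Bool} {j : ℕ} {b : Bool} (h : l[j]? = some b) :
    offset l (j + 1) = offset l j + (band b).length := by
  rw [offset, List.take_add_one, h, enc_append, List.length_append]
  simp [offset, enc]

theorem offset_lt_offset {l : List Bool} {j j' : ℕ} (h : j < j') (h' : j' ≤ l.length) :
    offset l j < offset l j' := by
  induction j' with
  | zero => omega
  | succ k ih =>
    have hb : l[k]? = some l[k] := List.getElem?_eq_getElem (by omega)
    have hpos : ∀ b : Bool, 0 < (band b).length := by decide
    rw [offset_succ hb]
    have := hpos l[k]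
    rcases Nat.lt_succ_iff_lt_or_eq.1 h with c | rfl
    · have := ih c (by omega)
      omega
    · omega

theorem offset_injOn {l : List Bool} {j j' : ℕ} (hj : j ≤ l.length) (hj' : j' ≤ l.length)
    (h : offset l j = offset l j') : j = j' := by
  rcases lt_trichotomy j j' with c | c | c
  · have := offset_lt_offset c hj'
    omega
  · exact c
  · have := offset_lt_offset c hj
    omega

theorem offset_le {l : List Bool} {j : ℕ} (hj : j ≤ l.length) :
    offset l j ≤ (enc bandV bandU l).length := by
  rcases hj.lt_or_eq with c | c
  · rw [← offset_length]
    exact (offset_lt_offset c le_rfl).le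
  · rw [c, offset_length]

theorem enc_getElem? {l : List Bool} {j r : ℕ} {b : Bool} {x : Letter} (h : l[j]? = some b)
    (hx : (band b)[r]? = some x) : (enc bandV bandU l)[offset l j + r]? = some x := by
  obtain ⟨hj, rfl⟩ := List.getElem?_eq_some_iff.1 h
  have h1 : l = l.take j ++ (l[j] :: l.drop (j + 1)) := by
    rw [← List.drop_eq_getElem_cons, List.take_append_drop]
  have h2 : enc bandV bandU l
      = enc bandV bandU (l.take j) ++ (band l[j] ++ enc bandV bandU (l.drop (j + 1))) := by
    conv_lhs => rw [h1]
    rw [enc_append, enc_cons]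
  rw [h2, offset, List.getElem?_append_right (by omega), Nat.add_sub_cancel_left,
    List.getElem?_append_left (List.getElem?_eq_some_iff.1 hx).1, hx]

theorem exists_block {l : List Bool} {i : ℕ} {x : Letter}
    (h : (enc bandV bandU l)[i]? = some x) :
    ∃ j b r, l[j]? = some b ∧ i = offset l j + r ∧ (band b)[r]? = some x := by
  induction l generalizing i with
  | nil => simp [enc] at h
  | cons b l ih =>
    rw [enc_cons] at h
    change (band b ++ _)[i]? = _ at h
    by_cases hi : i < (band b).length
    · rw [List.getElem?_append_left hi] at h
      exact ⟨0, b, i, by simp, by rw [offset_zero, zero_add], h⟩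
    · rw [List.getElem?_append_right (by omega)] at h
      obtain ⟨j, b', r, h1, h2, h3⟩ := ih h
      refine ⟨j + 1, b', r, by simpa using h1, ?_, h3⟩
      have : offset (b :: l) (j + 1) = (band b).length + offset l j := by
        simp only [offset, List.take_succ_cons, enc_cons, List.length_append]
      omega

variable {l : List Bool} {S : StringWord}

theorem getElem?_offset_add (hS : S.1 = enc bandV bandU l) {j r : ℕ} {b : Bool} {x : Letter}
    (h : l[j]? = some b) (hx : (band b)[r]? = some x) : S.1[offset l j + r]? = some x := by
  rw [hS]
  exact enc_getElem? h hx

/-- The last position starts no letter. Since it lies at vertex `5`, arguments about other vertices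
may ignore it. -/
theorem vertex_length (hS : S.1 = enc bandV bandU l) : S.vertex S.1.length = v5 := by
  obtain ⟨w, hw⟩ := S
  subst hS
  rcases List.eq_nil_or_concat l with rfl | ⟨l, b, rfl⟩
  · exact absurd rfl hw.1
  · have h : (enc bandV bandU (l.concat b)).getLast hw.1 = inv a2 := by
      apply Option.some_injective
      rw [← List.getLast?_eq_some_getLast, List.concat_eq_append, enc_append]
      cases b <;> simp [enc, bandU, bandV]
    simp only [StringWord.vertex, List.getElem?_eq_none le_rfl]
    rw [h]
    rfl

/-- A position whose vertex is not `5` is an inner position of a block. -/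
theorem exists_block_of_vertex (hS : S.1 = enc bandV bandU l) {i : ℕ} (hi : i ≤ S.1.length)
    {v : Vertex} (hv : S.vertex i = v) (h5 : v ≠ v5) :
    ∃ j b r x, l[j]? = some b ∧ i = offset l j + r ∧ (band b)[r]? = some x ∧ x.src = v := by
  rcases hx : S.1[i]? with _ | x
  · have : i = S.1.length := le_antisymm hi (List.getElem?_eq_none_iff.1 hx)
    rw [this, vertex_length hS] at hv
    exact absurd hv.symm h5
  · have hx' := hx
    rw [hS] at hx'
    obtain ⟨j, b, r, h1, h2, h3⟩ := exists_block hx'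
    exact ⟨j, b, r, x, h1, h2, h3, by rw [← hv, S.vertex_left hx]⟩

theorem letter_of_vertex_one (hS : S.1 = enc bandV bandU l) {i : ℕ} (hi : i ≤ S.1.length)
    (hv : S.vertex i = v1) : S.1[i]? = some (dir a1) := by
  obtain ⟨j, b, r, x, h1, rfl, h3, h4⟩ := exists_block_of_vertex hS hi hv (by decide)
  have key : ∀ b : Bool, ∀ x ∈ band b, x.src = v1 → x = dir a1 := by decide
  rw [getElem?_offset_add hS h1 h3, key b x (List.mem_of_getElem? h3) h4]

theorem letter_of_vertex_six (hS : S.1 = enc bandV bandU l) {i : ℕ} (hi : i ≤ S.1.length)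
    (hv : S.vertex i = v6) : S.1[i]? = some (inv b3) := by
  obtain ⟨j, b, r, x, h1, rfl, h3, h4⟩ := exists_block_of_vertex hS hi hv (by decide)
  have key : ∀ b : Bool, ∀ x ∈ band b, x.src = v6 → x = inv b3 := by decide
  rw [getElem?_offset_add hS h1 h3, key b x (List.mem_of_getElem? h3) h4]

theorem band_length_le (b : Bool) : (band b).length ≤ 8 := by cases b <;> decide

theorem letter_of_vertex_four (hS : S.1 = enc bandV bandU l) {i : ℕ} (hi : i ≤ S.1.length)
    (hv : S.vertex i = v4) : ∃ k, i = k + 1 ∧ S.1[k]? = some (dir b2) := by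
  obtain ⟨j, b, r, x, h1, rfl, h3, h4⟩ := exists_block_of_vertex hS hi hv (by decide)
  -- No band has more than eight letters, so a claim about positions in a block is a finite check.
  have key : ∀ b : Bool, ∀ r : Fin 8, ∀ x ∈ (band b)[r.val]?, x.src = v4 →
      1 ≤ r.val ∧ (band b)[r.val - 1]? = some (dir b2) := by decide
  have hr : r < 8 := lt_of_lt_of_le (List.getElem?_eq_some_iff.1 h3).1 (band_length_le b)
  obtain ⟨h5, h6⟩ := key b ⟨r, hr⟩ x h3 h4
  simp only at h5 h6
  exact ⟨offset l j + (r - 1), by omega, getElem?_offset_add hS h1 h6⟩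

/-- In `U`, and at its second occurrence in `V`, vertex `3` is followed by `a₂⁻¹`; at its first
occurrence in `V` it is preceded by `a₃a₁`. Hence `a₂` and `a₃a₁` together detect elements at vertex
`3`. -/
theorem letters_of_vertex_three (hS : S.1 = enc bandV bandU l) {i : ℕ} (hi : i ≤ S.1.length)
    (hv : S.vertex i = v3) : ∃ k, i = k + 1 ∧ S.1[k]? = some (dir a1) ∧
      (S.1[i]? = some (inv a2) ∨ ∃ k', k = k' + 1 ∧ S.1[k']? = some (dir a3)) := by
  obtain ⟨j, b, r, x, h1, rfl, h3, h4⟩ := exists_block_of_vertex hS hi hv (by decide)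
  have key : ∀ b : Bool, ∀ r : Fin 8, ∀ x ∈ (band b)[r.val]?, x.src = v3 →
      1 ≤ r.val ∧ (band b)[r.val - 1]? = some (dir a1) ∧
        ((band b)[r.val]? = some (inv a2) ∨
          2 ≤ r.val ∧ (band b)[r.val - 2]? = some (dir a3)) := by decide
  have hr : r < 8 := lt_of_lt_of_le (List.getElem?_eq_some_iff.1 h3).1 (band_length_le b)
  obtain ⟨h5, h6, h7⟩ := key b ⟨r, hr⟩ x h3 h4
  simp only at h5 h6 h7
  refine ⟨offset l j + (r - 1), by omega, getElem?_offset_add hS h1 h6, ?_⟩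
  rcases h7 with h7 | ⟨h7, h8⟩
  · exact Or.inl (getElem?_offset_add hS h1 h7)
  · exact Or.inr ⟨offset l j + (r - 2), by omega, getElem?_offset_add hS h1 h8⟩

/-- The boundaries between blocks. -/
def IsBoundary (l : List Bool) (i : ℕ) : Prop := ∃ j ≤ l.length, i = offset l j

theorem boundary_or_of_vertex_five (hS : S.1 = enc bandV bandU l) {i : ℕ} (hi : i ≤ S.1.length)
    (hv : S.vertex i = v5) : IsBoundary l i ∨ ∃ k, i = k + 1 ∧ S.1[k]? = some (dir c2) := by
  rcases hx : S.1[i]? with _ | x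
  · have : i = S.1.length := le_antisymm hi (List.getElem?_eq_none_iff.1 hx)
    exact Or.inl ⟨l.length, le_rfl, by rw [this, hS, offset_length]⟩
  · have h4 : x.src = v5 := by rw [← hv, S.vertex_left hx]
    rw [hS] at hx
    obtain ⟨j, b, r, h1, rfl, h3⟩ := exists_block hx
    have key : ∀ b : Bool, ∀ r : Fin 8, ∀ x ∈ (band b)[r.val]?, x.src = v5 →
        r.val = 0 ∨ 1 ≤ r.val ∧ (band b)[r.val - 1]? = some (dir c2) := by decide
    have hr : r < 8 := lt_of_lt_of_le (List.getElem?_eq_some_iff.1 h3).1 (band_length_le b)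
    rcases key b ⟨r, hr⟩ x h3 h4 with h5 | ⟨h5, h6⟩
    · simp only at h5
      exact Or.inl ⟨j, (List.getElem?_eq_some_iff.1 h1).1.le, by rw [h5, add_zero]⟩
    · simp only at h5 h6
      exact Or.inr ⟨offset l j + (r - 1), by omega, getElem?_offset_add hS h1 h6⟩

theorem vertex_eq (hS : S.1 = enc bandV bandU l) {i : ℕ} (hi : i ≤ S.1.length) :
    S.vertex i ∈ [v1, v3, v4, v5, v6] := by
  by_cases h : S.vertex i = v5
  · simp [h]
  · obtain ⟨j, b, r, x, h1, rfl, h3, h4⟩ := exists_block_of_vertex hS hi rfl h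
    have key : ∀ b : Bool, ∀ x ∈ band b, x.src ∈ [v1, v3, v4, v5, v6] := by decide
    rw [← h4]
    exact key b x (List.mem_of_getElem? h3)

theorem letter_mem (hS : S.1 = enc bandV bandU l) {i : ℕ} {x : Letter} (h : S.1[i]? = some x) :
    x ∈ bandV := by
  rw [hS] at h
  obtain ⟨j, b, r, h1, rfl, h3⟩ := exists_block h
  have key : ∀ b : Bool, ∀ x ∈ band b, x ∈ bandV := by decide
  exact key b x (List.mem_of_getElem? h3)

/-- The letter `a₃` only opens bands, so the action of `a₃` lands in the span of the boundaries. The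
same holds for `a₂`, since `a₂⁻¹` only closes bands. -/
theorem isBoundary_of_letter_a3 (hS : S.1 = enc bandV bandU l) {i : ℕ}
    (h : S.1[i]? = some (dir a3)) : IsBoundary l i := by
  rw [hS] at h
  obtain ⟨j, b, r, h1, rfl, h3⟩ := exists_block h
  have key : ∀ b : Bool, ∀ r : Fin 8, (band b)[r.val]? = some (dir a3) → r.val = 0 := by decide
  have hr : r < 8 := lt_of_lt_of_le (List.getElem?_eq_some_iff.1 h3).1 (band_length_le b)
  have h5 := key b ⟨r, hr⟩ h3
  simp only at h5
  exact ⟨j, (List.getElem?_eq_some_iff.1 h1).1.le, by rw [h5, add_zero]⟩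

theorem isBoundary_of_letter_a2 (hS : S.1 = enc bandV bandU l) {i : ℕ}
    (h : S.1[i]? = some (inv a2)) : IsBoundary l (i + 1) := by
  rw [hS] at h
  obtain ⟨j, b, r, h1, rfl, h3⟩ := exists_block h
  have key : ∀ b : Bool, ∀ r : Fin 8, (band b)[r.val]? = some (inv a2) →
      r.val + 1 = (band b).length := by decide
  have hr : r < 8 := lt_of_lt_of_le (List.getElem?_eq_some_iff.1 h3).1 (band_length_le b)
  have h5 := key b ⟨r, hr⟩ h3
  simp only at h5
  exact ⟨j + 1, (List.getElem?_eq_some_iff.1 h1).1, by rw [offset_succ h1, ← h5, add_assoc]⟩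

end Blocks

/-! ### The relations of the two bands -/

section Relations

variable {K : Type u} [Field K]

/-- The linear relations defined by the bands `U` and `V` on a module. -/
def BandRel (K : Type u) [Field K] {M : Type*} [AddCommGroup M] [Module (Lam K) M] :
    Bool → M → M → Prop
  | false, x, y => ∃ w : M, x = gen K (Sum.inr a3) • gen K (Sum.inr a1) • w ∧
      y = gen K (Sum.inr a2) • w
  | true, x, y => ∃ t s : M, x = gen K (Sum.inr a3) • gen K (Sum.inr a1) •
      gen K (Sum.inr b2) • gen K (Sum.inr c2) • t ∧
      gen K (Sum.inr b3) • gen K (Sum.inr c3) • t = gen K (Sum.inr a1) • s ∧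
      y = gen K (Sum.inr a2) • s

/-- The relations are existential systems of linear equations over `Λ`, and homomorphisms carry
solutions to solutions. -/
theorem BandRel.map {M N : Type*} [AddCommGroup M] [Module (Lam K) M] [AddCommGroup N]
    [Module (Lam K) N] (f : M →ₗ[Lam K] N) {b : Bool} {x y : M} (h : BandRel K b x y) :
    BandRel K b (f x) (f y) := by
  cases b
  · obtain ⟨w, rfl, rfl⟩ := h
    exact ⟨f w, by simp, by simp⟩
  · obtain ⟨t, s, rfl, h, rfl⟩ := h
    exact ⟨f t, f s, by simp, by simpa using congrArg f h, by simp⟩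

variable {l : List Bool} {S : StringWord}

theorem bandRel_basisVec (hS : S.1 = enc bandV bandU l) {j : ℕ} {b : Bool} (h : l[j]? = some b) :
    BandRel K b (basisVec K S (offset l j)) (basisVec K S (offset l (j + 1))) := by
  rw [offset_succ h]
  have hx {r : ℕ} {x : Letter} (h' : (band b)[r]? = some x) := getElem?_offset_add hS h h'
  cases b
  · refine ⟨basisVec K S (offset l j + 2), ?_, (arrow_basisVec_inv (hx rfl)).symm⟩
    rw [arrow_basisVec_dir (i := offset l j + 1) (hx rfl),
      arrow_basisVec_dir (i := offset l j) (hx (r := 0) rfl)]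
  · refine ⟨basisVec K S (offset l j + 4), basisVec K S (offset l j + 7), ?_, ?_,
      (arrow_basisVec_inv (hx rfl)).symm⟩
    · rw [arrow_basisVec_dir (i := offset l j + 3) (hx rfl),
        arrow_basisVec_dir (i := offset l j + 2) (hx rfl),
        arrow_basisVec_dir (i := offset l j + 1) (hx rfl),
        arrow_basisVec_dir (i := offset l j) (hx (r := 0) rfl)]
    · rw [arrow_basisVec_inv (i := offset l j + 4) (hx rfl),
        arrow_basisVec_inv (i := offset l j + 5) (hx rfl),
        arrow_basisVec_dir (i := offset l j + 6) (hx rfl)]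

/-- Inside the block each letter transports a coordinate unchanged from one position to the next,
along the chain of equations that defines the relation. -/
theorem coord_eq_of_bandRel (hS : S.1 = enc bandV bandU l) {j : ℕ} {b : Bool}
    (h : l[j]? = some b) {x y : StringModule K S} (hxy : BandRel K b x y) :
    coord (offset l j) x = coord (offset l (j + 1)) y := by
  rw [offset_succ h]
  have hx {r : ℕ} {x : Letter} (h' : (band b)[r]? = some x) := getElem?_offset_add hS h h'
  cases b
  · obtain ⟨w, rfl, rfl⟩ := hxy
    rw [coord_arrow_dir (i := offset l j) (hx (r := 0) rfl),
      coord_arrow_dir (i := offset l j + 1) (hx rfl)]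
    exact (coord_arrow_inv (i := offset l j + 2) (hx rfl) _).symm
  · obtain ⟨t, s, rfl, h, rfl⟩ := hxy
    rw [coord_arrow_dir (i := offset l j) (hx (r := 0) rfl),
      coord_arrow_dir (i := offset l j + 1) (hx rfl),
      coord_arrow_dir (i := offset l j + 2) (hx rfl),
      coord_arrow_dir (i := offset l j + 3) (hx rfl)]
    refine Eq.trans ?_ (coord_arrow_inv (i := offset l j + 7) (hx rfl) _).symm
    have h1 := congrArg (coord (offset l j + 6)) h
    rw [coord_arrow_dir (i := offset l j + 6) (hx rfl),
      coord_arrow_inv (i := offset l j + 5) (hx rfl),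
      coord_arrow_inv (i := offset l j + 4) (hx rfl)] at h1
    exact h1

/-- At a `U`-block the coordinate of `x` is one of an element `b₂ • _` at the position between `a₁`
and `a₂⁻¹`, which `b₂` does not reach. That of `y` is one of `b₃ • _` at the position between `a₃`
and `a₁`, which `b₃` does not reach. This one-sided vanishing is the source of the order on words.
-/
theorem coord_eq_zero_of_bandRel (hS : S.1 = enc bandV bandU l) {j : ℕ} (h : l[j]? = some false)
    {x y : StringModule K S} (hxy : BandRel K true x y) :
    coord (offset l j) x = 0 ∧ coord (offset l (j + 1)) y = 0 := by
  rw [offset_succ h]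
  have hx {r : ℕ} {x : Letter} (h' : (band false)[r]? = some x) := getElem?_offset_add hS h h'
  have h0 : S.1[offset l j]? = some (dir a3) := hx (r := 0) rfl
  have h1 : S.1[offset l j + 1]? = some (dir a1) := hx rfl
  have h2 : S.1[offset l j + 2]? = some (inv a2) := hx rfl
  obtain ⟨t, s, rfl, h, rfl⟩ := hxy
  constructor
  · rw [coord_arrow_dir h0, coord_arrow_dir h1, coord_arrow_eq_zero]
    · rw [h2]; decide
    · intro k hk
      obtain rfl : k = offset l j + 1 := by omega
      rw [h1]; decide
  · refine (coord_arrow_inv h2 _).trans ?_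
    rw [← coord_arrow_dir h1, ← h, coord_arrow_eq_zero]
    · rw [h1]; decide
    · intro k hk
      obtain rfl : k = offset l j := by omega
      rw [h0]; decide

/-- The element `x` lies in the image of `a₃`, which reaches a position only through an outgoing
letter `a₃` or an incoming `a₃⁻¹`; the last position has neither. -/
theorem coord_last_eq_zero_of_bandRel (hS : S.1 = enc bandV bandU l) {b : Bool}
    {x y : StringModule K S} (hxy : BandRel K b x y) : coord (offset l l.length) x = 0 := by
  obtain ⟨m, rfl⟩ : ∃ m, x = gen K (Sum.inr a3) • m := by
    cases b
    · obtain ⟨w, rfl, -⟩ := hxy; exact ⟨_, rfl⟩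
    · obtain ⟨t, s, rfl, -, -⟩ := hxy; exact ⟨_, rfl⟩
  rw [offset_length, ← hS]
  refine coord_arrow_eq_zero (by simp) (fun k _ h => ?_) _
  exact absurd (letter_mem hS h) (by decide)

theorem coord_first_eq_zero_of_bandRel (hS : S.1 = enc bandV bandU l) {b : Bool}
    {x y : StringModule K S} (hxy : BandRel K b x y) : coord (offset l 0) y = 0 := by
  obtain ⟨m, rfl⟩ : ∃ m, y = gen K (Sum.inr a2) • m := by
    cases b
    · obtain ⟨w, -, rfl⟩ := hxy; exact ⟨_, rfl⟩
    · obtain ⟨t, s, -, -, rfl⟩ := hxy; exact ⟨_, rfl⟩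
  rw [offset_zero]
  refine coord_arrow_eq_zero (fun h => ?_) (fun k hk => by omega) _
  exact absurd (letter_mem hS h) (by decide)

variable {l' : List Bool} {S' : StringWord}

theorem cons_le_cons_of_le (b : Bool) {x y : List Bool} (h : x ≤ y) : b :: x ≤ b :: y :=
  not_lt.1 fun c => not_lt.2 h (by simpa [List.cons_lt_cons_iff] using c)

/-- Homomorphisms respect the lexicographic order of the right parts. -/
theorem drop_le_of_coord_ne_zero (hS : S.1 = enc bandV bandU l) (hS' : S'.1 = enc bandV bandU l')
    (f : StringModule K S →ₗ[Lam K] StringModule K S') {j j' : ℕ} (hj : j ≤ l.length)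
    (hj' : j' ≤ l'.length) (h : coord (offset l' j') (f (basisVec K S (offset l j))) ≠ 0) :
    l.drop j ≤ l'.drop j' := by
  obtain ⟨n, hn⟩ : ∃ n, l.length = j + n := ⟨l.length - j, by omega⟩
  induction n generalizing j j' with
  | zero =>
    rw [List.drop_eq_nil_of_le (by omega)]
    exact not_lt.1 (List.not_lt_nil _)
  | succ n ih =>
    have hlj : j < l.length := by omega
    have hb : l[j]? = some l[j] := List.getElem?_eq_getElem hlj
    have hrel := (bandRel_basisVec (K := K) hS hb).map f
    rcases hj'.lt_or_eq with c | rfl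
    · have hb' : l'[j']? = some l'[j'] := List.getElem?_eq_getElem c
      rw [List.drop_eq_getElem_cons hlj, List.drop_eq_getElem_cons c]
      by_cases hbb : l[j] = l'[j']
      · rw [hbb] at hrel
        rw [coord_eq_of_bandRel hS' hb' hrel] at h
        have := ih (j := j + 1) (j' := j' + 1) (by omega) (by omega) h (by omega)
        rw [hbb]
        exact cons_le_cons_of_le _ this
      -- At a mismatch, `false` against `true` is the desired strict inequality, and `true` against
      -- `false` would make the coefficient vanish.
      · rcases hv : l[j] with _ | _
        · have hv' : l'[j'] = true := by
            rw [hv] at hbb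
            simpa using Ne.symm hbb
          rw [hv']
          exact (List.cons_lt_cons_iff.2 (Or.inl (by decide))).le
        · have hv' : l'[j'] = false := by
            rw [hv] at hbb
            simpa using Ne.symm hbb
          rw [hv] at hrel
          rw [hv'] at hb'
          exact absurd (coord_eq_zero_of_bandRel hS' hb' hrel).1 h
    · exact absurd (coord_last_eq_zero_of_bandRel hS' hrel) h

theorem reverse_take_succ {l : List Bool} {j : ℕ} {b : Bool} (h : l[j]? = some b) :
    (l.take (j + 1)).reverse = b :: (l.take j).reverse := by
  rw [List.take_add_one, h]
  simp

/-- Homomorphisms respect the lexicographic order of the left parts. -/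
theorem take_le_of_coord_ne_zero (hS : S.1 = enc bandV bandU l) (hS' : S'.1 = enc bandV bandU l')
    (f : StringModule K S →ₗ[Lam K] StringModule K S') {j j' : ℕ} (hj : j ≤ l.length)
    (hj' : j' ≤ l'.length) (h : coord (offset l' j') (f (basisVec K S (offset l j))) ≠ 0) :
    (l.take j).reverse ≤ (l'.take j').reverse := by
  induction j generalizing j' with
  | zero => exact not_lt.1 (List.not_lt_nil _)
  | succ j ih =>
    have hb : l[j]? = some l[j] := List.getElem?_eq_getElem hj
    have hrel := (bandRel_basisVec (K := K) hS hb).map f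
    cases j' with
    | zero => exact absurd (coord_first_eq_zero_of_bandRel hS' hrel) h
    | succ j' =>
      have hb' : l'[j']? = some l'[j'] := List.getElem?_eq_getElem hj'
      rw [reverse_take_succ hb, reverse_take_succ hb']
      by_cases hbb : l[j] = l'[j']
      · rw [hbb] at hrel
        rw [← coord_eq_of_bandRel hS' hb' hrel] at h
        rw [hbb]
        exact cons_le_cons_of_le _ (ih (by omega) (by omega) h)
      · rcases hv : l[j] with _ | _
        · have hv' : l'[j'] = true := by
            rw [hv] at hbb
            simpa using Ne.symm hbb
          rw [hv']
          exact (List.cons_lt_cons_iff.2 (Or.inl (by decide))).le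
        · have hv' : l'[j'] = false := by
            rw [hv] at hbb
            simpa using Ne.symm hbb
          rw [hv] at hrel
          rw [hv'] at hb'
          exact absurd (coord_eq_zero_of_bandRel hS' hb' hrel).2 h

/-- Homomorphisms in both directions matching two boundary points identify the words. -/
theorem code_eq_of_hom (hS : S.1 = enc bandV bandU l) (hS' : S'.1 = enc bandV bandU l')
    {f : StringModule K S →ₗ[Lam K] StringModule K S'}
    {g : StringModule K S' →ₗ[Lam K] StringModule K S} {j j' : ℕ} (hj : j ≤ l.length)
    (hj' : j' ≤ l'.length)
    (hf : f (basisVec K S (offset l j)) = basisVec K S' (offset l' j'))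
    (hg : g (basisVec K S' (offset l' j')) = basisVec K S (offset l j)) : l = l' := by
  have h1 : coord (offset l' j') (f (basisVec K S (offset l j))) ≠ 0 := by
    rw [hf, coord_basisVec (by rw [hS']; exact offset_le hj'), if_pos rfl]
    exact one_ne_zero
  have h2 : coord (offset l j) (g (basisVec K S' (offset l' j'))) ≠ 0 := by
    rw [hg, coord_basisVec (by rw [hS]; exact offset_le hj), if_pos rfl]
    exact one_ne_zero
  have h3 := le_antisymm (drop_le_of_coord_ne_zero hS hS' f hj hj' h1)
    (drop_le_of_coord_ne_zero hS' hS g hj' hj h2)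
  have h4 := le_antisymm (take_le_of_coord_ne_zero hS hS' f hj hj' h1)
    (take_le_of_coord_ne_zero hS' hS g hj' hj h2)
  rw [← List.take_append_drop j l, ← List.take_append_drop j' l', h3, List.reverse_injective h4]

/-- The diagonal coefficients of an endomorphism at the boundaries all agree. -/
theorem coord_diagonal (hS : S.1 = enc bandV bandU l) (f : Module.End (Lam K) (StringModule K S))
    {j : ℕ} (hj : j ≤ l.length) :
    coord (offset l j) (f (basisVec K S (offset l j))) = coord 0 (f (basisVec K S 0)) := by
  induction j with
  | zero => rfl
  | succ j ih =>
    have hb : l[j]? = some l[j] := List.getElem?_eq_getElem hj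
    rw [← ih (by omega)]
    exact (coord_eq_of_bandRel hS hb ((bandRel_basisVec hS hb).map f)).symm

theorem eq_sum_of_boundary (hS : S.1 = enc bandV bandU l) {x : StringModule K S}
    (hx : ∀ i, coord i x ≠ 0 → IsBoundary l i) :
    x = ∑ j ∈ Finset.range (l.length + 1), coord (offset l j) x • basisVec K S (offset l j) := by
  refine ext_coord fun i _ => ?_
  rw [map_sum]
  by_cases h : IsBoundary l i
  · obtain ⟨j, hj, rfl⟩ := h
    rw [Finset.sum_eq_single j]
    · rw [map_smul, coord_basisVec (by rw [hS]; exact offset_le hj), if_pos rfl, smul_eq_mul,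
        mul_one]
    · intro j' hj' hne
      have hj'' : j' ≤ l.length := Nat.lt_succ_iff.1 (Finset.mem_range.1 hj')
      rw [map_smul, coord_basisVec (by rw [hS]; exact offset_le hj''), if_neg, smul_zero]
      exact fun h => hne (offset_injOn hj hj'' h).symm
    · exact fun h => absurd (Finset.mem_range.2 (Nat.lt_succ_iff.2 hj)) h
  · rw [Finset.sum_eq_zero]
    · by_contra h0
      exact h (hx i h0)
    · intro j hj
      have hj' : j ≤ l.length := Nat.lt_succ_iff.1 (Finset.mem_range.1 hj)
      rw [map_smul, coord_basisVec (by rw [hS]; exact offset_le hj'), if_neg, smul_zero]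
      rintro rfl
      exact h ⟨j, hj', rfl⟩

/-- An endomorphism with non-zero diagonal coefficient is injective on the span of the
boundaries, where it is triangular. -/
theorem eq_zero_of_boundary (hS : S.1 = enc bandV bandU l)
    (f : Module.End (Lam K) (StringModule K S)) (hf : coord 0 (f (basisVec K S 0)) ≠ 0)
    {x : StringModule K S} (hx : ∀ i, coord i x ≠ 0 → IsBoundary l i) (h0 : f x = 0) : x = 0 := by
  classical
  by_contra hne
  set s := (Finset.range (l.length + 1)).filter fun j => coord (offset l j) x ≠ 0 with hs
  have hsne : s.Nonempty := by
    by_contra hemp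
    rw [Finset.not_nonempty_iff_eq_empty, Finset.filter_eq_empty_iff] at hemp
    refine hne ?_
    rw [eq_sum_of_boundary hS hx]
    refine Finset.sum_eq_zero fun j hj => ?_
    rw [not_not.1 (hemp hj), zero_smul]
  -- With the smallest right part chosen, triangularity leaves only the diagonal term in coordinate
  -- `j₀` of `f x`: any other contribution would have the same right part, hence the same length and
  -- the same index.
  obtain ⟨j₀, hj₀, hmin⟩ := s.exists_min_image (fun j => l.drop j) hsne
  rw [hs, Finset.mem_filter, Finset.mem_range] at hj₀
  have hle₀ : j₀ ≤ l.length := by omega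
  have h1 := congrArg (coord (offset l j₀)) h0
  have h2 : f x = ∑ j ∈ Finset.range (l.length + 1),
      coord (offset l j) x • f (basisVec K S (offset l j)) := by
    conv_lhs => rw [eq_sum_of_boundary hS hx]
    rw [map_sum]
    exact Finset.sum_congr rfl fun j _ => (f.restrictScalars K).map_smul _ _
  rw [h2, map_sum, map_zero, Finset.sum_eq_single j₀] at h1
  · rw [map_smul, coord_diagonal hS f hle₀, smul_eq_mul] at h1
    exact mul_ne_zero hj₀.2 hf h1
  · intro j hj hjne
    rw [map_smul, smul_eq_mul]
    by_contra hprod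
    have hj' : j ≤ l.length := Nat.lt_succ_iff.1 (Finset.mem_range.1 hj)
    have h3 := drop_le_of_coord_ne_zero hS hS f hj' hle₀ (right_ne_zero_of_mul hprod)
    have h4 := hmin j (Finset.mem_filter.2 ⟨hj, left_ne_zero_of_mul hprod⟩)
    have h5 := congrArg List.length (le_antisymm h3 h4)
    simp only [List.length_drop] at h5
    omega
  · exact fun h => absurd (Finset.mem_range.2 hj₀.1) h

theorem vertex_of_fixed {v : Vertex} {x : StringModule K S} (hx : gen K (Sum.inl v) • x = x)
    {i : ℕ} (hi : coord i x ≠ 0) : S.vertex i = v := by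
  by_contra h
  rw [← hx, coord_vertex, if_neg h] at hi
  exact hi rfl

/-- If every position at `v` touches a letter through which `a` moves it away, each coordinate of
`x` reappears as a coordinate of `a • x`. -/
theorem arrow_injective_of_vertex {v : Vertex} {a : Arrow}
    (h : ∀ i ≤ S.1.length, S.vertex i = v → S.1[i]? = some (inv a) ∨
      ∃ k, i = k + 1 ∧ S.1[k]? = some (dir a)) {x : StringModule K S}
    (hx : gen K (Sum.inl v) • x = x) (h0 : gen K (Sum.inr a) • x = 0) : x = 0 := by
  refine ext_coord fun i hi => ?_
  rw [map_zero]
  by_contra hne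
  rcases h i hi (vertex_of_fixed hx hne) with c | ⟨k, rfl, c⟩
  · rw [← coord_arrow_inv c, h0, map_zero] at hne
    exact hne rfl
  · rw [← coord_arrow_dir c, h0, map_zero] at hne
    exact hne rfl

theorem eq_zero_of_vertex_three (hS : S.1 = enc bandV bandU l) {x : StringModule K S}
    (hx : gen K (Sum.inl v3) • x = x)
    (h1 : gen K (Sum.inr a3) • gen K (Sum.inr a1) • x = 0) (h2 : gen K (Sum.inr a2) • x = 0) :
    x = 0 := by
  refine ext_coord fun i hi => ?_
  rw [map_zero]
  by_contra hne
  obtain ⟨k, rfl, hk, c | ⟨k', rfl, c⟩⟩ := letters_of_vertex_three hS hi (vertex_of_fixed hx hne)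
  · rw [← coord_arrow_inv c, h2, map_zero] at hne
    exact hne rfl
  · rw [← coord_arrow_dir hk, ← coord_arrow_dir c, h1, map_zero] at hne
    exact hne rfl

/-- An endomorphism with non-zero diagonal coefficient is injective. -/
theorem injective_of_diagonal_ne_zero (hS : S.1 = enc bandV bandU l)
    (f : Module.End (Lam K) (StringModule K S)) (hf : coord 0 (f (basisVec K S 0)) ≠ 0) :
    Function.Injective f := by
  have hP {x : StringModule K S} := eq_zero_of_boundary hS f hf (x := x)
  have hfix (v : Vertex) (x : StringModule K S) :
      gen K (Sum.inl v) • gen K (Sum.inl v) • x = gen K (Sum.inl v) • x := by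
    rw [← mul_smul]
    have := gen_rel K (AlgRel.idem v)
    rw [map_mul] at this
    exact congrArg (· • x) this
  have hno (a : Arrow) (h : inv a ∉ bandV) {i : ℕ} : S.1[i]? ≠ some (inv a) :=
    fun h' => h (letter_mem hS h')
  have hno' (a : Arrow) (h : dir a ∉ bandV) {i : ℕ} : S.1[i]? ≠ some (dir a) :=
    fun h' => h (letter_mem hS h')
  have ha3 (y : StringModule K S) (i : ℕ) (h : coord i (gen K (Sum.inr a3) • y) ≠ 0) :
      IsBoundary l i := by
    by_contra hb
    exact h (coord_arrow_eq_zero (fun c => hb (isBoundary_of_letter_a3 hS c))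
      (fun k _ => hno a3 (by decide)) y)
  have ha2 (y : StringModule K S) (i : ℕ) (h : coord i (gen K (Sum.inr a2) • y) ≠ 0) :
      IsBoundary l i := by
    by_contra hb
    refine h (coord_arrow_eq_zero (hno' a2 (by decide)) (fun k hk c => hb ?_) y)
    rw [hk]
    exact isBoundary_of_letter_a2 hS c
  have hinj1 {y : StringModule K S} (hy : gen K (Sum.inl v3) • y = y)
      (h0 : gen K (Sum.inr a1) • y = 0) : y = 0 :=
    arrow_injective_of_vertex (fun i hi hv => by
      obtain ⟨k, hk, hk', -⟩ := letters_of_vertex_three hS hi hv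
      exact Or.inr ⟨k, hk, hk'⟩) hy h0
  -- Both `a₃a₁x` and `a₂x` are killed by `f` and supported on boundaries, so they vanish.
  have h3 {x : StringModule K S} (hx : gen K (Sum.inl v3) • x = x) (h0 : f x = 0) : x = 0 := by
    refine eq_zero_of_vertex_three hS hx (hP (ha3 _) ?_) (hP (ha2 _) ?_)
    · rw [map_smul, map_smul, h0, smul_zero, smul_zero]
    · rw [map_smul, h0, smul_zero]
  have h1 {x : StringModule K S} (hx : gen K (Sum.inl v1) • x = x) (h0 : f x = 0) : x = 0 := by
    -- Every position at vertex `1` starts a letter `a₁`, so shifting `x` by one place gives a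
    -- preimage under `a₁` at vertex `3`. As `a₁` is injective there, `f w = 0` follows and `h3`
    -- applies to `w`.
    let w : StringModule K S := ofCoord S fun i => if 1 ≤ i then coord (i - 1) x else 0
    have hw (i : ℕ) : coord (i + 1) w = coord i x := by
      rw [coord_ofCoord, if_pos (by omega : 1 ≤ i + 1), Nat.add_sub_cancel]
      split_ifs with h
      · rfl
      · by_contra hne
        have hi : i ≤ S.1.length := le_of_coord_ne_zero (Ne.symm hne)
        have := letter_of_vertex_one hS hi (vertex_of_fixed hx (Ne.symm hne))
        have := (List.getElem?_eq_some_iff.1 this).1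
        omega
    have hw3 : gen K (Sum.inl v3) • w = w := by
      refine ext_coord fun i hi => ?_
      rw [coord_vertex]
      split_ifs with h
      · rfl
      · cases i with
        | zero => rw [coord_ofCoord]; simp
        | succ i =>
          by_contra hne
          rw [hw] at hne
          have := letter_of_vertex_one hS (by omega) (vertex_of_fixed hx (Ne.symm hne))
          exact h (S.vertex_right this)
    have hax : gen K (Sum.inr a1) • w = x := by
      refine ext_coord fun i hi => ?_
      by_cases c : S.1[i]? = some (dir a1)
      · rw [coord_arrow_dir c, hw]
      · rw [coord_arrow_eq_zero c (fun k _ => hno a1 (by decide))]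
        by_contra hne
        exact c (letter_of_vertex_one hS hi (vertex_of_fixed hx (Ne.symm hne)))
    have hfw : f w = 0 := by
      refine hinj1 ?_ ?_
      · rw [← map_smul, hw3]
      · rw [← map_smul, hax, h0]
    rw [← hax, h3 hw3 hfw, smul_zero]
  have h4 {x : StringModule K S} (hx : gen K (Sum.inl v4) • x = x) (h0 : f x = 0) : x = 0 := by
    refine arrow_injective_of_vertex
      (fun i hi hv => Or.inr (letter_of_vertex_four hS hi hv)) hx (h3 ?_ ?_)
    · have := gen_rel K (AlgRel.src b2)
      rw [map_mul] at this
      rw [← mul_smul]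
      exact congrArg (· • x) this
    · rw [map_smul, h0, smul_zero]
  have h6 {x : StringModule K S} (hx : gen K (Sum.inl v6) • x = x) (h0 : f x = 0) : x = 0 := by
    refine arrow_injective_of_vertex
      (fun i hi hv => Or.inl (letter_of_vertex_six hS hi hv)) hx (h1 ?_ ?_)
    · have := gen_rel K (AlgRel.src b3)
      rw [map_mul] at this
      rw [← mul_smul]
      exact congrArg (· • x) this
    · rw [map_smul, h0, smul_zero]
  have h5 {x : StringModule K S} (hx : gen K (Sum.inl v5) • x = x) (h0 : f x = 0) : x = 0 := by
    -- The positions at vertex `5` that are not boundaries lie behind a letter `c₂`; once `c₂x`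
    -- vanishes by the case of vertex `4`, `x` is supported on boundaries.
    have hc : gen K (Sum.inr c2) • x = 0 := by
      refine h4 ?_ ?_
      · have := gen_rel K (AlgRel.src c2)
        rw [map_mul] at this
        rw [← mul_smul]
        exact congrArg (· • x) this
      · rw [map_smul, h0, smul_zero]
    refine hP (x := x) (fun i hi => ?_) h0
    rcases boundary_or_of_vertex_five hS (le_of_coord_ne_zero hi) (vertex_of_fixed hx hi) with
      hb | ⟨k, rfl, hk⟩
    · exact hb
    · rw [← coord_arrow_dir hk, hc, map_zero] at hi
      exact absurd rfl hi
  refine (injective_iff_map_eq_zero f).2 fun x h0 => eq_zero_of_vertex (K := K) fun v => ?_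
  have hv0 : f (gen K (Sum.inl v) • x) = 0 := by rw [map_smul, h0, smul_zero]
  have hv := hfix v x
  by_cases hmem : v ∈ [v1, v3, v4, v5, v6]
  · simp only [List.mem_cons, List.not_mem_nil, or_false] at hmem
    rcases hmem with rfl | rfl | rfl | rfl | rfl
    · exact h1 hv hv0
    · exact h3 hv hv0
    · exact h4 hv hv0
    · exact h5 hv hv0
    · exact h6 hv hv0
  · refine ext_coord fun i hi => ?_
    rw [coord_vertex, if_neg, map_zero]
    rintro rfl
    exact hmem (vertex_eq hS hi)

/-- The endomorphism ring of the string module of a word in the two bands is local. -/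
theorem isLocalRing_end (hS : S.1 = enc bandV bandU l) :
    IsLocalRing (Module.End (Lam K) (StringModule K S)) := by
  have hcoord : coord 0 (basisVec K S 0) = 1 := by
    rw [coord_basisVec (Nat.zero_le _), if_pos rfl]
  have hz : basisVec K S 0 ≠ 0 := by
    intro h
    rw [h, map_zero] at hcoord
    exact zero_ne_one hcoord
  have hunit (f : Module.End (Lam K) (StringModule K S))
      (hf : coord 0 (f (basisVec K S 0)) ≠ 0) : IsUnit f := by
    have hi := injective_of_diagonal_ne_zero hS f hf
    exact (Module.End.isUnit_iff f).2
      ⟨hi, (LinearMap.injective_iff_surjective (f := f.restrictScalars K)).1 hi⟩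
  have : Nontrivial (StringModule K S) := ⟨_, _, hz⟩
  have : Nontrivial (Module.End (Lam K) (StringModule K S)) := by
    refine ⟨1, 0, fun h => hz ?_⟩
    exact LinearMap.congr_fun h (basisVec K S 0)
  refine IsLocalRing.of_isUnit_or_isUnit_one_sub_self fun f => ?_
  -- The diagonal coefficients of `f` and `1 - f` add up to `1`, so one of them is non-zero.
  by_cases hf : coord 0 (f (basisVec K S 0)) = 0
  · refine Or.inr (hunit _ ?_)
    rw [LinearMap.sub_apply, Module.End.one_apply, map_sub, hf, sub_zero, hcoord]
    exact one_ne_zero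
  · exact Or.inl (hunit f hf)

end Relations

/-! ### Homomorphisms between string modules -/

section Homs

variable {K : Type u} [Field K]

/-- The linear map of string modules that reads off the coordinate `σ i` at the positions `i`
satisfying `p`. -/
def pullback (S T : StringWord) (p : ℕ → Prop) [DecidablePred p] (σ : ℕ → ℕ) :
    StringModule K S →ₗ[K] StringModule K T where
  toFun m := ofCoord T fun i => if p i then coord (σ i) m else 0
  map_add' m m' := by
    refine ext_coord fun i hi => ?_
    rw [map_add, coord_ofCoord, coord_ofCoord, coord_ofCoord]
    split_ifs <;> simp
  map_smul' c m := by
    refine ext_coord fun i hi => ?_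
    rw [map_smul, coord_ofCoord, coord_ofCoord]
    split_ifs <;> simp

theorem coord_pullback {S T : StringWord} {p : ℕ → Prop} [DecidablePred p] {σ : ℕ → ℕ}
    (hp : ∀ i, p i → T.1.length < i → S.1.length < σ i) (m : StringModule K S) (i : ℕ) :
    coord i (pullback S T p σ m) = if p i then coord (σ i) m else 0 := by
  refine (coord_ofCoord (S := T) (fun i => if p i then coord (σ i) m else 0) i).trans ?_
  split_ifs with h1 h2 h3
  · rfl
  · rfl
  · rw [coord_of_lt (hp i h3 (by omega))]
  · rfl

/-- This reduces `Λ`-linearity to a comparison of neighbouring letters. Condition `hp` keeps the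
coordinate formula valid beyond the end of `T`, so positions such as `i + 1` need no separate range
check. -/
theorem exists_pullback_hom {S T : StringWord} {p : ℕ → Prop} [DecidablePred p] {σ : ℕ → ℕ}
    (hp : ∀ i, p i → T.1.length < i → S.1.length < σ i)
    (hv : ∀ i ≤ T.1.length, p i → S.vertex (σ i) = T.vertex i)
    (ha : ∀ (a : Arrow) (m : StringModule K S), ∀ i ≤ T.1.length,
      (if p i then (if S.1[σ i]? = some (dir a) then coord (σ i + 1) m else 0) +
        (if 1 ≤ σ i ∧ S.1[σ i - 1]? = some (inv a) then coord (σ i - 1) m else 0) else 0) =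
      (if T.1[i]? = some (dir a) then if p (i + 1) then coord (σ (i + 1)) m else 0 else 0) +
        (if 1 ≤ i ∧ T.1[i - 1]? = some (inv a) then
          if p (i - 1) then coord (σ (i - 1)) m else 0 else 0)) :
    ∃ f : StringModule K S →ₗ[Lam K] StringModule K T,
      ∀ m i, coord i (f m) = if p i then coord (σ i) m else 0 := by
  refine ⟨coordHom (pullback S T p σ) (fun v m i hi => ?_) (fun a m i hi => ?_),
    fun m i => coord_pullback hp m i⟩
  · rw [coord_pullback hp, coord_pullback hp, coord_vertex]
    by_cases h : p i
    · rw [if_pos h, if_pos h, hv i hi h]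
    · simp [h]
  · rw [coord_pullback hp, coord_arrow, coord_arrow, coord_pullback hp, coord_pullback hp]
    exact ha a m i hi

theorem vertex_eq_of_prefix {S T : StringWord} {P s t : Word} (hP : P ≠ []) (hS : S.1 = P ++ s)
    (hT : T.1 = P ++ t) {i : ℕ} (hi : i ≤ P.length) : S.vertex i = T.vertex i := by
  have key {j : ℕ} (hj : j < P.length) : S.1[j]? = some P[j] ∧ T.1[j]? = some P[j] := by
    rw [hS, hT, List.getElem?_append_left hj, List.getElem?_append_left hj]
    simp
  rcases hi.lt_or_eq with c | rfl
  · rw [S.vertex_left (key c).1, T.vertex_left (key c).2]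
  -- At the end of the prefix the next letters may differ or be absent; the vertices agree as the
  -- target of the last letter of `P`.
  · have hpos := List.length_pos_of_ne_nil hP
    have h1 : P.length - 1 < P.length := by omega
    have h2 : P.length - 1 + 1 = P.length := by omega
    rw [← h2, S.vertex_right (key h1).1, T.vertex_right (key h1).2]

/-- The graph map between string modules given by a common prefix that is a factor string of
`S` and a substring of `T`. -/
theorem exists_prefix_hom (K : Type u) [Field K] {S T : StringWord} {P s t : Word} (hP : P ≠ [])
    (hS : S.1 = P ++ s)
    (hT : T.1 = P ++ t) (hs : ∀ a, s.head? ≠ some (dir a)) (ht : ∀ a, t.head? ≠ some (inv a)) :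
    ∃ f : StringModule K S →ₗ[Lam K] StringModule K T,
      ∀ m i, coord i (f m) = if i ≤ P.length then coord i m else 0 := by
  have hS' : S.1.length = P.length + s.length := by rw [hS, List.length_append]
  have hT' : T.1.length = P.length + t.length := by rw [hT, List.length_append]
  have key {j : ℕ} (hj : j < P.length) : S.1[j]? = T.1[j]? := by
    rw [hS, hT, List.getElem?_append_left hj, List.getElem?_append_left hj]
  have hsP (a : Arrow) : S.1[P.length]? ≠ some (dir a) := by
    rw [hS, List.getElem?_append_right le_rfl, Nat.sub_self, ← List.head?_eq_getElem?]
    exact hs a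
  have htP (a : Arrow) : T.1[P.length]? ≠ some (inv a) := by
    rw [hT, List.getElem?_append_right le_rfl, Nat.sub_self, ← List.head?_eq_getElem?]
    exact ht a
  refine exists_pullback_hom (σ := fun i => i) (fun i h h' => by omega)
    (fun i _ h => vertex_eq_of_prefix hP hS hT h) fun a m i _ => ?_
  rcases lt_trichotomy i P.length with c | rfl | c
  · rw [if_pos c.le, key c, key (by omega : i - 1 < P.length), if_pos (by omega : i + 1 ≤ P.length),
      if_pos (by omega : i - 1 ≤ P.length)]
  · have hpos := List.length_pos_of_ne_nil hP
    rw [if_pos le_rfl, if_neg (hsP a), key (by omega : P.length - 1 < P.length),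
      if_neg (by omega : ¬ P.length + 1 ≤ P.length), if_pos (by omega : P.length - 1 ≤ P.length),
      ite_self]
  -- Past the prefix, the only possible leak is from `P.length` to `P.length + 1` across an inverse
  -- letter of `T`, which `ht` excludes.
  · rw [if_neg (by omega), if_neg (by omega : ¬ i + 1 ≤ P.length), ite_self, zero_add]
    by_cases h : i - 1 ≤ P.length
    · have h1 : i - 1 = P.length := by omega
      rw [if_neg]
      rw [h1]
      exact fun h => htP a h.2
    · rw [if_neg h, ite_self]

/-- The inclusion of the string module of a suffix that is preceded by an inverse letter. -/
theorem exists_suffix_hom (K : Type u) [Field K] {S T : StringWord} {W : Word}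
    (hT : T.1 = W ++ S.1) (hW : ∀ a, W.getLast? ≠ some (dir a)) :
    ∃ f : StringModule K S →ₗ[Lam K] StringModule K T,
      ∀ m i, coord i (f m) = if W.length ≤ i then coord (i - W.length) m else 0 := by
  have hT' : T.1.length = W.length + S.1.length := by rw [hT, List.length_append]
  have key {j : ℕ} (hj : W.length ≤ j) : T.1[j]? = S.1[j - W.length]? := by
    rw [hT, List.getElem?_append_right hj]
  refine exists_pullback_hom (σ := fun i => i - W.length) (fun i h h' => by omega)
    (fun i _ h => ?_) fun a m i _ => ?_
  · unfold StringWord.vertex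
    rw [key h]
    have : T.1.getLast T.2.1 = S.1.getLast S.2.1 := by
      simp only [hT]
      exact List.getLast_append_of_ne_nil _ S.2.1
    rw [this]
  · rcases lt_trichotomy i W.length with c | rfl | c
    -- Before the suffix, the only possible leak is into position `W.length - 1` across a direct
    -- last letter of `W`, which `hW` excludes.
    · rw [if_neg (by omega), if_neg (by omega : ¬ W.length ≤ i - 1), ite_self, add_zero]
      by_cases h : W.length ≤ i + 1
      · rw [if_neg]
        intro h1
        rw [hT, List.getElem?_append_left c] at h1
        refine hW a ?_
        rw [List.getLast?_eq_getElem?, ← h1]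
        congr 1
        omega
      · rw [if_neg h, ite_self]
    · have h1 : W.length + 1 - W.length = W.length - W.length + 1 := by omega
      rw [if_pos le_rfl, key le_rfl, if_pos (by omega : W.length ≤ W.length + 1), h1,
        if_neg (by omega : ¬ (1 ≤ W.length - W.length ∧ _))]
      congr 1
      by_cases h2 : 1 ≤ W.length
      · rw [if_neg (by omega : ¬ W.length ≤ W.length - 1), ite_self]
      · rw [if_neg (fun h => h2 h.1)]
    · have h1 : i + 1 - W.length = i - W.length + 1 := by omega
      have h2 : i - W.length - 1 = i - 1 - W.length := by omega
      rw [if_pos c.le, key c.le, key (by omega : W.length ≤ i - 1),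
        if_pos (by omega : W.length ≤ i + 1), if_pos (by omega : W.length ≤ i - 1), h1, h2]
      simp only [(by omega : 1 ≤ i - W.length), (by omega : 1 ≤ i), true_and]

theorem wordInv_getElem? {w : Word} {i : ℕ} (hi : i < w.length) :
    (wordInv w)[i]? = w[w.length - 1 - i]?.map op := by
  rw [wordInv, List.getElem?_reverse (by simpa using hi), List.getElem?_map, List.length_map]

theorem exists_reverse_hom (K : Type u) [Field K] {S T : StringWord} (hT : T.1 = wordInv S.1) :
    ∃ f : StringModule K S →ₗ[Lam K] StringModule K T,
      ∀ m i, coord i (f m) = if i ≤ S.1.length then coord (S.1.length - i) m else 0 := by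
  have hT' : T.1.length = S.1.length := by rw [hT, wordInv_length]
  have key {i : ℕ} (hi : i < S.1.length) : T.1[i]? = S.1[S.1.length - 1 - i]?.map op := by
    rw [hT, wordInv_getElem? hi]
  have hdir (a : Arrow) {i k : ℕ} (hk : i + k + 1 = S.1.length) :
      T.1[i]? = some (dir a) ↔ S.1[k]? = some (inv a) := by
    rw [key (by omega), (by omega : S.1.length - 1 - i = k)]
    rcases S.1[k]? with _ | (b | b) <;> simp [op]
  have hinv (a : Arrow) {i k : ℕ} (hk : i + k + 1 = S.1.length) :
      T.1[i]? = some (inv a) ↔ S.1[k]? = some (dir a) := by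
    rw [key (by omega), (by omega : S.1.length - 1 - i = k)]
    rcases S.1[k]? with _ | (b | b) <;> simp [op]
  have hpos := List.length_pos_of_ne_nil S.2.1
  refine exists_pullback_hom (σ := fun i => S.1.length - i) (fun i h h' => by omega)
    (fun i _ h => ?_) fun a m i hi => ?_
  · rcases h.lt_or_eq with c | rfl
    · have h1 : S.1[S.1.length - 1 - i]? = some (S.1[S.1.length - 1 - i]'(by omega)) :=
        List.getElem?_eq_getElem _
      have h2 := key c
      rw [h1, Option.map_some] at h2
      rw [T.vertex_left h2, (by omega : S.1.length - i = S.1.length - 1 - i + 1),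
        S.vertex_right h1]
      cases S.1[S.1.length - 1 - i]'(by omega) <;> rfl
    · have h1 : S.1[0]? = some (S.1[0]'hpos) := List.getElem?_eq_getElem _
      have h2 := key (i := S.1.length - 1) (by omega)
      rw [(by omega : S.1.length - 1 - (S.1.length - 1) = 0), h1, Option.map_some] at h2
      have h3 := T.vertex_right h2
      rw [(by omega : S.1.length - 1 + 1 = S.1.length)] at h3
      rw [h3, Nat.sub_self, S.vertex_left h1]
      cases S.1[0]'hpos <;> rfl
  · rw [hT'] at hi
    rw [if_pos hi, add_comm]
    congr 1
    · rcases hi.lt_or_eq with c | rfl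
      · rw [if_pos (by omega : i + 1 ≤ S.1.length), Nat.sub_add_eq]
        simp only [hdir a (i := i) (k := S.1.length - i - 1) (by omega),
          (by omega : 1 ≤ S.1.length - i), true_and]
      · rw [if_neg (by omega), if_neg (by omega : ¬ S.1.length + 1 ≤ S.1.length), ite_self]
    · rcases Nat.eq_zero_or_pos i with rfl | c
      · rw [if_neg (by simp), if_neg (by omega)]
      · rw [if_pos (by omega : i - 1 ≤ S.1.length), (by omega : S.1.length - (i - 1) =
          S.1.length - i + 1)]
        simp only [hinv a (i := i - 1) (k := S.1.length - i) (by omega), (by omega : 1 ≤ i),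
          true_and]

/-- The string modules of a string and of its inverse are isomorphic. -/
theorem exists_reverse_equiv (K : Type u) [Field K] {S T : StringWord} (hT : T.1 = wordInv S.1) :
    ∃ e : StringModule K S ≃ₗ[Lam K] StringModule K T,
      ∀ m i, coord i (e m) = if i ≤ S.1.length then coord (S.1.length - i) m else 0 := by
  have hT' : T.1.length = S.1.length := by rw [hT, wordInv_length]
  obtain ⟨f, hf⟩ := exists_reverse_hom K hT
  obtain ⟨g, hg⟩ := exists_reverse_hom K (S := T) (T := S) (by rw [hT, wordInv_wordInv])
  refine ⟨LinearEquiv.ofLinearMap f g ?_ ?_, hf⟩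
  · refine LinearMap.ext fun m => ext_coord fun i hi => ?_
    rw [LinearMap.comp_apply, hf, hg, hT', if_pos (by omega), if_pos (by omega),
      Nat.sub_sub_self (by omega)]
    rfl
  · refine LinearMap.ext fun m => ext_coord fun i hi => ?_
    rw [LinearMap.comp_apply, hg, hf, hT', if_pos (by omega), if_pos (by omega),
      Nat.sub_sub_self (by omega)]
    rfl

/-- If `S < T`, then after the common prefix `T` ends or has an inverse letter, and `S` ends or has
a direct letter. The prefix thus gives a quotient of `M(T)` and a submodule of `M(S)`, and the graph
map preserves the first basis vector. -/
theorem hasHom_of_stringLT (K : Type u) [Field K] {S T : StringWord} {a : Arrow}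
    (hT : T.1.head? = some (dir a)) (h : StringLT S.1 T.1) :
    (canonicalPointed K T).HasHom (canonicalPointed K S) := by
  have key {P s t : Word} (hP : P ≠ []) (hS : S.1 = P ++ s) (hT : T.1 = P ++ t)
      (hs : ∀ a, s.head? ≠ some (inv a)) (ht : ∀ a, t.head? ≠ some (dir a)) :
      (canonicalPointed K T).HasHom (canonicalPointed K S) := by
    obtain ⟨f, hf⟩ := exists_prefix_hom K hP hT hS ht hs
    refine ⟨f, ?_⟩
    change f (StringModule.z K T 0) = StringModule.z K S 0
    rw [z_zero_eq, z_zero_eq]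
    refine ext_coord fun i hi => ?_
    rw [hf, coord_basisVec (Nat.zero_le _), coord_basisVec (Nat.zero_le _)]
    split_ifs <;> first | rfl | omega
  rcases h with ⟨φ, X, h1⟩ | ⟨ψ, X, h1⟩ | ⟨P, φ, ψ, W, X, h1, h2⟩
  · exact key S.2.1 (s := []) (by simp) h1 (by simp) (by simp)
  · exact key T.2.1 (t := []) h1 (by simp) (by simp) (by simp)
  -- An empty common prefix would make `T` begin with an inverse letter.
  · refine key ?_ h1 h2 (by simp) (by simp)
    rintro rfl
    rw [h2] at hT
    simp at hT

/-- The pushout of the pointed string modules of `X` and `Y` is the string module of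
`Y⁻¹ X`, pointed at the junction. -/
theorem exists_pushout_equiv (K : Type u) [Field K] {X Y Q : StringWord}
    (hQ : Q.1 = wordInv Y.1 ++ X.1) {a b : Arrow} (hX : X.1.head? = some (dir a))
    (hY : Y.1.head? = some (dir b)) :
    ∃ e : ((canonicalPointed K X).pushout (canonicalPointed K Y)).carrier ≃ₗ[Lam K]
        StringModule K Q,
      e ((canonicalPointed K X).pushout (canonicalPointed K Y)).pt
        = basisVec K Q Y.1.length := by
  set n := Y.1.length with hn
  have hlen : (wordInv Y.1).length = n := wordInv_length _
  have hQlen : Q.1.length = n + X.1.length := by rw [hQ, List.length_append, hlen]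
  let W : StringWord := ⟨wordInv Y.1, isString_wordInv.2 Y.2⟩
  obtain ⟨f, hf⟩ := exists_suffix_hom K hQ (by
    intro c h
    rw [wordInv, List.getLast?_reverse, List.head?_map, hY] at h
    simp [op] at h)
  obtain ⟨r, hr⟩ := exists_reverse_hom K (S := Y) (T := W) rfl
  obtain ⟨p, hp⟩ := exists_prefix_hom K (S := W) (T := Q) W.2.1 (List.append_nil _).symm hQ
    (by simp) (by simp [hX])
  let G : (StringModule K X × StringModule K Y) →ₗ[Lam K] StringModule K Q := f.coprod (p.comp r)
  have hG (x : StringModule K X) (y : StringModule K Y) (i : ℕ) : coord i (G (x, y)) =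
      (if n ≤ i then coord (i - n) x else 0) + (if i ≤ n then coord (n - i) y else 0) := by
    change coord i (f x + p (r y)) = _
    rw [map_add, hf, hp, hr, hlen]
    congr 1
    split_ifs <;> rfl
  have hsurj : Function.Surjective G := by
    intro q
    -- The junction coordinate is assigned to `X` alone, and so set to `0` on the side of `Y`, to
    -- avoid counting it twice.
    refine ⟨(ofCoord X fun i => coord (i + n) q,
      ofCoord Y fun i => if i = 0 then 0 else coord (n - i) q), ext_coord fun i hi => ?_⟩
    rw [hG, coord_ofCoord, coord_ofCoord]
    by_cases c : n ≤ i
    · rw [if_pos c, if_pos (by omega), Nat.sub_add_cancel c]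
      simp only [(by omega : n - i = 0), if_true, ite_self, add_zero]
    · rw [if_neg c, if_pos (by omega : i ≤ n), if_pos (by omega), if_neg (by omega),
        Nat.sub_sub_self (by omega), zero_add]
  -- The two images overlap only in the junction vector, so the kernel is the line of multiples of
  -- `(z, -z)`; scalars from `K` already produce it.
  have hker : LinearMap.ker G = Submodule.span (Lam K)
      {((basisVec K X 0, -basisVec K Y 0) : StringModule K X × StringModule K Y)} := by
    apply le_antisymm
    · rintro ⟨x, y⟩ hxy
      have hc (i : ℕ) : (if n ≤ i then coord (i - n) x else 0) +
          (if i ≤ n then coord (n - i) y else 0) = 0 := by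
        rw [← hG, LinearMap.mem_ker.1 hxy, map_zero]
      rw [Submodule.mem_span_singleton]
      refine ⟨algebraMap K (Lam K) (coord 0 x), Prod.ext ?_ ?_⟩
      · change algebraMap K (Lam K) (coord 0 x) • basisVec K X 0 = x
        rw [algebraMap_smul]
        refine ext_coord fun i _ => ?_
        rw [map_smul, coord_basisVec (Nat.zero_le _)]
        by_cases h0 : i = 0
        · simp [h0]
        · have := hc (n + i)
          rw [if_pos (by omega), if_neg (by omega), Nat.add_sub_cancel_left, add_zero] at this
          rw [this, if_neg h0, smul_zero]
      · change algebraMap K (Lam K) (coord 0 x) • -basisVec K Y 0 = y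
        rw [algebraMap_smul]
        refine ext_coord fun i hi => ?_
        rw [map_smul, map_neg, coord_basisVec (Nat.zero_le _)]
        by_cases h0 : i = 0
        · have := hc n
          rw [if_pos le_rfl, if_pos le_rfl, Nat.sub_self] at this
          rw [h0, if_pos rfl, smul_neg, smul_eq_mul, mul_one]
          exact neg_eq_of_add_eq_zero_right this
        · have := hc (n - i)
          rw [if_neg (by omega), if_pos (by omega), Nat.sub_sub_self hi, zero_add] at this
          rw [this, if_neg h0, neg_zero, smul_zero]
    · rw [Submodule.span_singleton_le_iff_mem, LinearMap.mem_ker]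
      refine ext_coord fun i hi => ?_
      rw [hG, map_neg, coord_basisVec (Nat.zero_le _), coord_basisVec (Nat.zero_le _), map_zero]
      rcases lt_trichotomy i n with c | c | c
      · rw [if_neg (by omega), if_pos c.le, if_neg (by omega)]
        simp
      · simp [c]
      · rw [if_pos c.le, if_neg (by omega), if_neg (by omega)]
        simp
  have hpt : ((StringModule.z K X 0, -StringModule.z K Y 0) : StringModule K X × StringModule K Y)
      = (basisVec K X 0, -basisVec K Y 0) := by rw [z_zero_eq, z_zero_eq]
  rw [← hpt] at hker
  let e := (Submodule.quotEquivOfEq _ _ hker.symm).trans (G.quotKerEquivOfSurjective hsurj)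
  refine ⟨e, ?_⟩
  change G (StringModule.z K X 0, 0) = _
  rw [z_zero_eq]
  refine ext_coord fun i hi => ?_
  rw [hG, coord_basisVec (Nat.zero_le _), coord_basisVec (by omega), map_zero, ite_self, add_zero]
  split_ifs <;> first | rfl | omega

end Homs

/-! ### Pointed modules realized by words in the two bands -/

section Realization

variable {K : Type u} [Field K]

/-- The pointed module `M` is the string module of the word encoded by `l`, pointed at
the beginning of the `j`-th band. -/
def Realizes (M : PointedModule.{u, u} (Lam K)) (l : List Bool) (j : ℕ) : Prop :=
  j ≤ l.length ∧ ∃ S : StringWord, S.1 = enc bandV bandU l ∧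
    ∃ e : M.carrier ≃ₗ[Lam K] StringModule K S, e M.pt = basisVec K S (offset l j)

variable {M N : PointedModule.{u, u} (Lam K)} {l l' : List Bool} {j j' : ℕ}

theorem Realizes.isLocalRing (h : Realizes M l j) :
    IsLocalRing (Module.End (Lam K) M.carrier) := by
  obtain ⟨_, S, hS, e, _⟩ := h
  have := isLocalRing_end (K := K) hS
  let φ := e.symm.conjRingEquiv
  have : Nontrivial (Module.End (Lam K) M.carrier) := φ.injective.nontrivial
  refine IsLocalRing.of_isUnit_or_isUnit_one_sub_self fun f => ?_
  have h := IsLocalRing.isUnit_or_isUnit_of_add_one (add_sub_cancel (φ.symm f) 1)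
  rwa [← map_one φ.symm, ← map_sub, MulEquiv.isUnit_map, MulEquiv.isUnit_map] at h

theorem Realizes.pt_ne_zero (h : Realizes M l j) : M.pt ≠ 0 := by
  obtain ⟨hj, S, hS, e, he⟩ := h
  intro h0
  rw [h0, map_zero] at he
  have := congrArg (coord (offset l j)) he
  rw [map_zero, coord_basisVec (by rw [hS]; exact offset_le hj), if_pos rfl] at this
  exact zero_ne_one this

/-- The boundaries `j` and `j'` need not agree in advance: comparing the parts left and right of the
distinguished points determines the whole code. -/
theorem Realizes.code_eq (h : Realizes M l j) (h' : Realizes N l' j') (hMN : M.IsIso N) :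
    l = l' := by
  obtain ⟨hj, S, hS, e, he⟩ := h
  obtain ⟨hj', S', hS', e', he'⟩ := h'
  obtain ⟨f, hf⟩ := hMN
  refine code_eq_of_hom (K := K) hS hS' (f := ((e.symm.trans f).trans e').toLinearMap)
    (g := ((e'.symm.trans f.symm).trans e).toLinearMap) hj hj' ?_ ?_
  · simp [← he, ← he', hf]
  · simp [← he, ← he', ← hf]

/-- Each block has `a₁` as its second letter, and no primed letter occurs in either band. -/
theorem Realizes.isEmpty_twist (h : Realizes M l j) (h' : Realizes N l' j') :
    IsEmpty (Twist (gAut K) M.carrier ≃ₗ[Lam K] N.carrier) := by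
  obtain ⟨-, S, hS, e, -⟩ := h
  obtain ⟨-, S', hS', e', -⟩ := h'
  apply isEmpty_twist_linearEquiv (a := a1)
  · obtain ⟨b, t, rfl⟩ : ∃ b t, l = b :: t := by
      cases l with
      | nil => exact absurd hS S.2.1
      | cons b t => exact ⟨b, t, rfl⟩
    have h1 : S.1[offset (b :: t) 0 + 1]? = some (dir a1) :=
      getElem?_offset_add hS (b := b) rfl (by cases b <;> rfl)
    refine ⟨e.symm (basisVec K S (offset (b :: t) 0 + 1 + 1)), fun h0 => ?_⟩
    rw [← map_smul, arrow_basisVec_dir h1, LinearEquiv.map_eq_zero_iff] at h0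
    have := congrArg (coord (offset (b :: t) 0 + 1)) h0
    rw [map_zero, coord_basisVec (List.getElem?_eq_some_iff.1 h1).1.le, if_pos rfl] at this
    exact one_ne_zero this
  · intro n
    rw [← e'.map_eq_zero_iff, map_smul]
    refine ext_coord fun i _ => ?_
    rw [map_zero]
    exact coord_arrow_eq_zero (fun h => absurd (letter_mem hS' h) (by decide))
      (fun k _ h => absurd (letter_mem hS' h) (by decide)) _

theorem realizes_canonicalPointed {S : StringWord} (hS : S.1 = enc bandV bandU l) :
    Realizes (canonicalPointed K S) l 0 :=
  ⟨Nat.zero_le _, S, hS, LinearEquiv.refl _ _, z_zero_eq⟩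

theorem offset_append_length (l l' : List Bool) :
    offset (l ++ l') l.length = (enc bandV bandU l).length := by
  rw [offset, List.take_left]

theorem enc_wordInv (l : List Bool) :
    wordInv (enc (wordInv bandV) (wordInv bandU) l) = enc bandV bandU l.reverse := by
  rw [wordInv_enc, wordInv_wordInv, wordInv_wordInv]

/-- Reversing the string turns a word in the inverse bands into one in `V` and `U`, and moves the
distinguished point to its end. -/
theorem realizes_canonicalPointed_inv {S : StringWord}
    (hS : S.1 = enc (wordInv bandV) (wordInv bandU) l) :
    Realizes (canonicalPointed K S) l.reverse l.length := by
  let T : StringWord := ⟨wordInv S.1, isString_wordInv.2 S.2⟩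
  have hT : T.1 = enc bandV bandU l.reverse := by
    rw [← enc_wordInv, ← hS]
  obtain ⟨e, he⟩ := exists_reverse_equiv K (S := S) (T := T) rfl
  refine ⟨by simp, T, hT, e, ?_⟩
  have h1 : offset l.reverse l.length = S.1.length := by
    rw [← List.length_reverse, offset_length, ← hT]
    exact wordInv_length _
  rw [h1]
  change e (StringModule.z K S 0) = _
  rw [z_zero_eq]
  refine ext_coord fun i hi => ?_
  have hi' : i ≤ S.1.length := hi.trans_eq (wordInv_length _)
  rw [he, if_pos hi', coord_basisVec (Nat.zero_le _),
    coord_basisVec (wordInv_length S.1).ge]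
  split_ifs <;> first | rfl | omega

theorem head?_enc {A B : Word} {a : Arrow} (hA : A.head? = some (dir a))
    (hB : B.head? = some (dir a)) (hl : l ≠ []) : (enc A B l).head? = some (dir a) := by
  obtain ⟨b, t, rfl⟩ := List.exists_cons_of_ne_nil hl
  rw [enc_cons, List.head?_append]
  cases b <;> simp [hA, hB]

theorem ne_nil_of_enc {A B : Word} {S : StringWord} (hS : S.1 = enc A B l) : l ≠ [] := by
  rintro rfl
  exact S.2.1 hS

theorem realizes_pushout {X Y : StringWord} (hX : X.1 = enc bandV bandU l)
    (hY : Y.1 = enc (wordInv bandV) (wordInv bandU) l') :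
    Realizes ((canonicalPointed K X).pushout (canonicalPointed K Y)) (l'.reverse ++ l)
      l'.length := by
  have hne := ne_nil_of_enc hX
  have hYi : wordInv Y.1 = enc bandV bandU l'.reverse := by rw [hY, enc_wordInv]
  let Q : StringWord := ⟨enc bandV bandU (l'.reverse ++ l), isString_enc (by simp [hne])⟩
  obtain ⟨e, he⟩ := exists_pushout_equiv K (Q := Q) (X := X) (Y := Y) (a := a3) (b := a2)
    (by rw [hYi, hX, ← enc_append])
    (by rw [hX]; exact head?_enc rfl rfl hne)
    (by rw [hY]; exact head?_enc rfl rfl (ne_nil_of_enc hY))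
  refine ⟨by simp, Q, rfl, e, ?_⟩
  rw [he, ← List.length_reverse (as := l'), offset_append_length, ← hYi, wordInv_length]

end Realization

/-! ### The main result -/

/-- Members of the chains and their pushouts all satisfy `Realizes`, and the code of a pushout is a
concatenation. Cancelling the fixed factor recovers the other index, which gives independence. -/
theorem isNonSymmetricPair_LFamily (K : Type u) [Field K] (s t s' t' : List Bool) :
    IsNonSymmetricPair (gAut K)
      (LIndex.lt (S := enc bandV bandU s) (T := enc bandV bandU t) (U := bandV) (V := bandU))
      (LFamily K (enc bandV bandU s) (enc bandV bandU t) bandV bandU)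
      (LIndex.lt (S := enc (wordInv bandV) (wordInv bandU) s')
        (T := enc (wordInv bandV) (wordInv bandU) t') (U := wordInv bandV) (V := wordInv bandU))
      (LFamily K (enc (wordInv bandV) (wordInv bandU) s')
        (enc (wordInv bandV) (wordInv bandU) t') (wordInv bandV) (wordInv bandU)) := by
  have hcode (X : LIndex (enc bandV bandU s) (enc bandV bandU t) bandV bandU) :
      ∃ x, X.1.1 = enc bandV bandU x :=
    ⟨_, (mem_LSet_enc_iff.1 X.2).choose_spec⟩
  have hcode' (Y : LIndex (enc (wordInv bandV) (wordInv bandU) s')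
      (enc (wordInv bandV) (wordInv bandU) t') (wordInv bandV) (wordInv bandU)) :
      ∃ y, Y.1.1 = enc (wordInv bandV) (wordInv bandU) y :=
    ⟨_, (mem_LSet_enc_iff.1 Y.2).choose_spec⟩
  choose c hc using hcode
  choose c' hc' using hcode'
  have hinj : Function.Injective c := fun X Y h =>
    Subtype.ext (Subtype.ext (by rw [hc X, hc Y, h]))
  have hinj' : Function.Injective c' := fun X Y h =>
    Subtype.ext (Subtype.ext (by rw [hc' X, hc' Y, h]))
  have hR (X) : Realizes (LFamily K _ _ _ _ X) (c X) 0 := realizes_canonicalPointed (hc X)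
  have hR' (Y) : Realizes (LFamily K _ _ _ _ Y) (c' Y).reverse (c' Y).length :=
    realizes_canonicalPointed_inv (hc' Y)
  have hP (X Y) : Realizes ((LFamily K _ _ _ _ X).pushout (LFamily K _ _ _ _ Y))
      ((c' Y).reverse ++ c X) (c' Y).length := realizes_pushout (hc X) (hc' Y)
  refine
    { independent :=
        { left :=
            { chain := isQChain_LIndex isDirectedPair_band (fun _ => isString_enc) s t
              finitelyPresented := fun X => finitePresentation_stringModule K X.1
              localEnd := fun X => (hR X).isLocalRing
              pt_ne_zero := fun X => (hR X).pt_ne_zero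
              hom := fun X Y h => hasHom_of_stringLT K (a := a3) ?_ h
              not_iso := fun X Y h hi => h (hinj ((hR X).code_eq (hR Y) hi)) }
          right :=
            { chain := isQChain_LIndex isDirectedPair_wordInv_band
                (fun _ => isString_enc_wordInv) s' t'
              finitelyPresented := fun X => finitePresentation_stringModule K X.1
              localEnd := fun X => (hR' X).isLocalRing
              pt_ne_zero := fun X => (hR' X).pt_ne_zero
              hom := fun X Y h => hasHom_of_stringLT K (a := a2) ?_ h
              not_iso := fun X Y h hi =>
                h (hinj' (List.reverse_injective ((hR' X).code_eq (hR' Y) hi))) }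
          localEnd := fun X Y => (hP X Y).isLocalRing
          not_iso_left := fun X X' Y h hi =>
            h (hinj (List.append_cancel_left ((hP X Y).code_eq (hP X' Y) hi)))
          not_iso_right := fun X Y Y' h hi =>
            h (hinj' (List.reverse_injective
              (List.append_cancel_right ((hP X Y).code_eq (hP X Y') hi)))) }
      left := fun X X' => (hR X).isEmpty_twist (hR X')
      right := fun Y Y' => (hR' Y).isEmpty_twist (hR' Y')
      pushout := fun X Y X' Y' => (hP X Y).isEmpty_twist (hP X' Y') }
  · rw [hc X]
    exact head?_enc rfl rfl (ne_nil_of_enc (hc X))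
  · rw [hc' X]
    exact head?_enc rfl rfl (ne_nil_of_enc (hc' X))

end FivePunctures

theorem theorem4p4 (K : Type u) [Field K] :
    -- the two pairs of bands are `Q`-generating
    IsQGenerating bandV bandU ∧
    IsQGenerating (wordInv bandV) (wordInv bandU) ∧
    -- the words that occur below are strings
    (∀ X ∈ Sig bandU bandV, X ≠ [] → IsString X) ∧
    (∀ Y ∈ Sig (wordInv bandU) (wordInv bandV), Y ≠ [] → IsString Y) ∧
    (∀ X ∈ Sig bandU bandV, ∀ Y ∈ Sig (wordInv bandU) (wordInv bandV),
      X ≠ [] → Y ≠ [] → IsString (wordInv Y ++ X)) ∧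
    -- the non-symmetric independent pair of dense chains
    (∀ S ∈ Sig bandU bandV, ∀ T ∈ Sig bandU bandV,
      ∀ S' ∈ Sig (wordInv bandU) (wordInv bandV), ∀ T' ∈ Sig (wordInv bandU) (wordInv bandV),
      IsNonSymmetricPair (gAut K)
        (LIndex.lt (S := S) (T := T) (U := bandV) (V := bandU))
        (LFamily K S T bandV bandU)
        (LIndex.lt (S := S') (T := T') (U := wordInv bandV) (V := wordInv bandU))
        (LFamily K S' T' (wordInv bandV) (wordInv bandU))) ∧
    -- the explicit non-isomorphisms between string modules
    (∀ S₁ S₂ : StringWord, S₁.1 ∈ Sig bandU bandV → S₂.1 ∈ Sig bandU bandV →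
      IsEmpty (Twist (gAut K) (StringModule K S₁) ≃ₗ[Lam K] StringModule K S₂)) ∧
    (∀ T₁ T₂ : StringWord, T₁.1 ∈ Sig (wordInv bandU) (wordInv bandV) →
      T₂.1 ∈ Sig (wordInv bandU) (wordInv bandV) →
      IsEmpty (Twist (gAut K) (StringModule K T₁) ≃ₗ[Lam K] StringModule K T₂)) ∧
    (∀ S₁ S₂ T₁ T₂ P₁ P₂ : StringWord, S₁.1 ∈ Sig bandU bandV → S₂.1 ∈ Sig bandU bandV →
      T₁.1 ∈ Sig (wordInv bandU) (wordInv bandV) →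
      T₂.1 ∈ Sig (wordInv bandU) (wordInv bandV) →
      P₁.1 = wordInv T₁.1 ++ S₁.1 → P₂.1 = wordInv T₂.1 ++ S₂.1 →
      IsEmpty (Twist (gAut K) (StringModule K P₁) ≃ₗ[Lam K] StringModule K P₂)) := by
  -- The alphabet is unordered, so words in `U`, `V` can be coded with `V` as the letter `true`.
  have hinv : ∀ Y ∈ Sig (wordInv bandU) (wordInv bandV), ∃ l,
      Y = enc (wordInv bandV) (wordInv bandU) l := fun Y hY => by
    rwa [sig_comm, mem_sig_iff] at hY
  have hdir : ∀ X ∈ Sig bandU bandV, ∃ l, X = enc bandV bandU l := fun X hX => by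
    rwa [sig_comm, mem_sig_iff] at hX
  refine ⟨isQGenerating_band, isQGenerating_wordInv_band, ?_, ?_, ?_, ?_, ?_, ?_, ?_⟩
  · intro X hX hne
    obtain ⟨l, rfl⟩ := hdir X hX
    exact isString_enc (by rintro rfl; exact hne rfl)
  · intro Y hY hne
    obtain ⟨l, rfl⟩ := hinv Y hY
    exact isString_enc_wordInv (by rintro rfl; exact hne rfl)
  · intro X hX Y hY hne _
    obtain ⟨l, rfl⟩ := hdir X hX
    obtain ⟨l', rfl⟩ := hinv Y hY
    rw [enc_wordInv, ← enc_append]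
    refine isString_enc fun h => hne ?_
    rw [(List.append_eq_nil_iff.1 h).2, enc_nil]
  · intro S hS T hT S' hS' T' hT'
    obtain ⟨s, rfl⟩ := hdir S hS
    obtain ⟨t, rfl⟩ := hdir T hT
    obtain ⟨s', rfl⟩ := hinv S' hS'
    obtain ⟨t', rfl⟩ := hinv T' hT'
    exact isNonSymmetricPair_LFamily K s t s' t'
  · intro S₁ S₂ h₁ h₂
    obtain ⟨l₁, h₁⟩ := hdir _ h₁
    obtain ⟨l₂, h₂⟩ := hdir _ h₂
    exact (realizes_canonicalPointed h₁).isEmpty_twist (realizes_canonicalPointed h₂)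
  · intro T₁ T₂ h₁ h₂
    obtain ⟨l₁, h₁⟩ := hinv _ h₁
    obtain ⟨l₂, h₂⟩ := hinv _ h₂
    exact (realizes_canonicalPointed_inv h₁).isEmpty_twist (realizes_canonicalPointed_inv h₂)
  · intro S₁ S₂ T₁ T₂ P₁ P₂ hS₁ hS₂ hT₁ hT₂ hP₁ hP₂
    have key {S T P : StringWord} (hS : S.1 ∈ Sig bandU bandV)
        (hT : T.1 ∈ Sig (wordInv bandU) (wordInv bandV)) (hP : P.1 = wordInv T.1 ++ S.1) :
        ∃ l, P.1 = enc bandV bandU l := by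
      obtain ⟨s, hs⟩ := hdir _ hS
      obtain ⟨t, ht⟩ := hinv _ hT
      exact ⟨t.reverse ++ s, by rw [hP, hs, ht, enc_wordInv, enc_append]⟩
    obtain ⟨l₁, h₁⟩ := key hS₁ hT₁ hP₁
    obtain ⟨l₂, h₂⟩ := key hS₂ hT₂ hP₂
    exact (realizes_canonicalPointed h₁).isEmpty_twist (realizes_canonicalPointed h₂)
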